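/- An election consists of a set $C=\{c_1,\dots,c_m\}$ of $m\ge 2$ parties, $n\ge 1$ voters, and a preference order $O_i$ (a linear order on $C$) for each voter $i$; write $\mathcal O=(O_1,\dots,O_n)$. Let $pos(O_i,c)\in\{1,\dots,m\}$ be the position of party $c$ in $O_i$, and let $\mathrm{Borda}(O_i,c)=m-pos(O_i,c)$. For a set $S\subseteq C$ of parties let $\mathrm{Borda}(\mathcal O,S)=\sum_{i=1}^n\sum_{c\in S}\mathrm{Borda}(O_i,c)$. Without a threshold, the fraction of seats allotted to $S$ is $\sigma(\mathcal O,S)=\mathrm{Borda}(\mathcal O,S)/\mathrm{Borda}(\mathcal O,C)$. A bribe replaces $\mathcal O$ by orders $\hat{\mathcal O}=(\hat O_1,\dots,\hat O_n)$ and costs $\pi(\mathcal O,\hat{\mathcal O})=\sum_{i=1}^n\pi_i(O_i,\hat O_i)$. The bribery types are as follows. * $1$-bribery: all changes are permissible; $\pi_i(O_i,\hat O_i)=1$ if $\hat O_i\neq O_i$, and $0$ otherwise. * $\$$-bribery: all changes are permissible; voter $i$ has a price $p_i\in\mathbb N$, and $\pi_i(O_i,\hat O_i)=p_i$ if $\hat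 O_i\neq O_i$, and $0$ otherwise. * Coalition-shift-bribery, for a coalition $A\subseteq C$: a change from $O_i$ to $\hat O_i$ is permissible iff there are no $x\in A$, $y\in C\setminus A$ such that $x$ is above $y$ in $O_i$ and below $y$ in $\hat O_i$; the cost is $\pi_i(O_i,\hat O_i)=s_i\bigl(|\{(x,y): y\text{ is below }x\text{ in }O_i\text{ and above }x\text{ in }\hat O_i\}|\bigr)$, where $s_i:\{0,\dots,\binom m2\}\to\mathbb N$ is a given non-decreasing function. For each of these types, the problem Borda$_0$-CB (coalition bribery under Borda without threshold) is the following. Given an election, a coalition $A\subseteq C$, the prices of the voters (nothing for $1$-bribery, the $p_i$ for $\$$-bribery, the tables of values of the $s_i$ for coalition-shift-bribery), a budget $B\in\mathbb N$ and a target support $\varphi\in[0,1]\cap\mathbb Q$, decide whether there is a permissible bribe $\hat{\mathcal O}$ such that $$\pi(\mathcal O,\hat{\mathcal O})\le B\qquad\text{and}\qquad \sigma(\hat{\mathcal O},A)\ge\varphi\cdot\sigma(\hat{\mathcal O},C).$$ **Corollary.** Borda$_0$-CB can be solved in polynomial time for $1$-bribery, for $\$$-bribery and for coalition-shift-bribery.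 That is, for each of the three types there is a Turing machine that decides the problem on every instance in a number of steps bounded by a polynomial in the length of the instance, where orders are given as lists of parties and all numbers are written in binary. -/

import Mathlib

namespace CoalitionBribery

/-! ### Elections, scoring and seat allocation -/

/-- A preference order over the parties `Fin m`, given by the map sending each party to its rank
(`0` is the top rank). -/
abbrev PrefOrder (m : ℕ) : Type := Equiv.Perm (Fin m)

/-- The position of a party, counted from `1` (top) to `m` (bottom). -/
def pos {m : ℕ} (O : PrefOrder m) (c : Fin m) : ℕ := (O c : ℕ) + 1

/-- Party `x` is above party `y` in the order `O`. -/
abbrev Above {m : ℕ} (O : PrefOrder m) (x y : Fin m) : Prop := pos O x < pos O y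

/-- A scoring function: the points which an order gives to a party. -/
abbrev ScoringFunction (m : ℕ) : Type := PrefOrder m → Fin m → ℚ

/-- The Borda scoring function `m - pos(O, c)`. -/
def borda (m : ℕ) : ScoringFunction m := fun O c => (m : ℚ) - (pos O c : ℚ)

/-- The total number of points that the orders of all voters give to a set of parties. -/
def points {m n : ℕ} (γ : ScoringFunction m) (O : Fin n → PrefOrder m) (S : Finset (Fin m)) : ℚ :=
  ∑ i, ∑ c ∈ S, γ (O i) c

/-- The active parties for the threshold `t`: those that do not get less than a `t` fraction of
the total number of points. -/
def activeParties {m n : ℕ} (γ : ScoringFunction m) (t : ℚ) (O : Fin n → PrefOrder m) :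
    Finset (Fin m) :=
  Finset.univ.filter fun c => ¬ points γ O {c} < t * points γ O Finset.univ

/-- The fraction of seats allotted to a party. -/
def seats {m n : ℕ} (γ : ScoringFunction m) (t : ℚ) (O : Fin n → PrefOrder m) (c : Fin m) : ℚ :=
  if c ∈ activeParties γ t O then
    points γ O {c} / ∑ c' ∈ activeParties γ t O, points γ O {c'}
  else 0

/-- The fraction of seats allotted to a set of parties. -/
def seatsOf {m n : ℕ} (γ : ScoringFunction m) (t : ℚ) (O : Fin n → PrefOrder m)
    (S : Finset (Fin m)) : ℚ :=
  ∑ c ∈ S, seats γ t O c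

/-! ### Bribery -/

/-- The rules of a bribery: for every voter, which changes of the preference order are permissible
and what they cost. -/
structure BriberyRules (m n : ℕ) where
  /-- voter `i` may be moved from the first order to the second one -/
  permissible : Fin n → PrefOrder m → PrefOrder m → Prop
  /-- the cost of moving voter `i` from the first order to the second one -/
  cost : Fin n → PrefOrder m → PrefOrder m → ℕ

/-- `$`-bribery with prices `p`: every change is permissible; changing the order of voter `i` in
any way costs `p i` (and leaving it unchanged costs nothing). -/
def dollarBribery (m : ℕ) {n : ℕ} (p : Fin n → ℕ) : BriberyRules m n where
  permissible _ _ _ := True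
  cost i O O' := if O' = O then 0 else p i

/-- `1`-bribery: every change is permissible and every changed order costs `1`. -/
def oneBribery (m n : ℕ) : BriberyRules m n where
  permissible _ _ _ := True
  cost _ O O' := if O' = O then 0 else 1

/-- The pairs of parties `(x, y)` such that `y` is below `x` in `O` and above `x` in `O'`. -/
def swappedPairs {m : ℕ} (O O' : PrefOrder m) : Finset (Fin m × Fin m) :=
  Finset.univ.filter fun q => Above O q.1 q.2 ∧ Above O' q.2 q.1

/-- There are at most `m.choose 2` swapped pairs. -/
theorem card_swappedPairs_lt {m : ℕ} (O O' : PrefOrder m) :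
    (swappedPairs O O').card < m.choose 2 + 1 := by
  have h : (swappedPairs O O').card ≤ ((Finset.univ : Finset (Fin m)).powersetCard 2).card := by
    refine Finset.card_le_card_of_injOn (fun q => {q.1, q.2}) ?_ ?_
    · rintro ⟨x, y⟩ hq
      simp only [swappedPairs, Finset.coe_filter, Finset.mem_univ, true_and,
        Set.mem_ofPred_eq] at hq
      have hne : x ≠ y := by
        rintro rfl
        exact lt_irrefl _ hq.1
      simp [Finset.mem_powersetCard, Finset.card_pair hne]
    · rintro ⟨x, y⟩ hq ⟨z, w⟩ hr heq
      simp only [swappedPairs, Finset.coe_filter, Finset.mem_univ, true_and,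
        Set.mem_ofPred_eq] at hq hr
      have hxy : ({x, y} : Finset (Fin m)) = {z, w} := heq
      have hx : x = z ∨ x = w := by
        have : x ∈ ({z, w} : Finset (Fin m)) := by rw [← hxy]; simp
        simpa using this
      have hy : y = z ∨ y = w := by
        have : y ∈ ({z, w} : Finset (Fin m)) := by rw [← hxy]; simp
        simpa using this
      have h1 := hq.1
      have h2 := hr.1
      rcases hx with rfl | rfl <;> rcases hy with rfl | rfl
      · exact absurd h1 (lt_irrefl _)
      · rfl
      · exact absurd h1 (not_lt.2 h2.le)
      · exact absurd h1 (lt_irrefl _)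
  rw [Finset.card_powersetCard, Finset.card_univ, Fintype.card_fin] at h
  exact Nat.lt_succ_of_le h

/-- Coalition-shift-bribery for the coalition `A`: a party of `A` may never fall below a party
outside `A` which it was above, and the cost is a monotone function `s i` of the number of swapped
pairs, which lies in `{0, …, m.choose 2}`. -/
def coalitionShiftBribery {m n : ℕ} (A : Finset (Fin m))
    (s : Fin n → (Fin (m.choose 2 + 1) →o ℕ)) : BriberyRules m n where
  permissible _ O O' := ∀ x ∈ A, ∀ y ∉ A, ¬ (Above O x y ∧ Above O' y x)
  cost i O O' := s i ⟨(swappedPairs O O').card, card_swappedPairs_lt O O'⟩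

/-! ### The coalition-bribery problem -/

/-- An instance of the coalition-bribery problem. `Price m n` is the type of the additional data
which describe the prices for `m` parties and `n` voters. There is at least one voter and there
are at least two parties, so that the total number of Borda points is positive. -/
structure Instance (Price : ℕ → ℕ → Type) where
  /-- the number of parties -/
  m : ℕ
  /-- the number of voters -/
  n : ℕ
  two_le_m : 2 ≤ m
  one_le_n : 1 ≤ n
  /-- the voters' preference orders -/
  order : Fin n → PrefOrder m
  /-- the coalition -/
  A : Finset (Fin m)
  /-- the target support -/
  φ : ℚ
  φ_nonneg : 0 ≤ φ
  φ_le_one : φ ≤ 1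
  /-- the budget -/
  B : ℕ
  /-- the prices -/
  price : Price m n

/-- The question of the coalition-bribery problem for the scoring functions `γ`, the threshold `t`
and the bribery type `rules` (whose rules may depend on the coalition and on the prices): is
there a permissible bribe which does not exceed the budget and after which the coalition reaches
the target support? -/
def CB {Price : ℕ → ℕ → Type} (γ : (m : ℕ) → ScoringFunction m) (t : ℚ)
    (rules : {m n : ℕ} → Finset (Fin m) → Price m n → BriberyRules m n)
    (I : Instance Price) : Prop :=
  ∃ O' : Fin I.n → PrefOrder I.m,
    (∀ i, (rules I.A I.price).permissible i (I.order i) (O' i)) ∧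
    ∑ i, (rules I.A I.price).cost i (I.order i) (O' i) ≤ I.B ∧
    seatsOf (γ I.m) t O' I.A ≥ I.φ * seatsOf (γ I.m) t O' Finset.univ

/-- No price data (`1`-bribery). -/
abbrev OnePrice (_ _ : ℕ) : Type := Unit

/-- One price for each voter (`$`-bribery). -/
abbrev DollarPrice (_ n : ℕ) : Type := Fin n → ℕ

/-- One monotone price function for each voter (coalition-shift-bribery). -/
abbrev ShiftPrice (m n : ℕ) : Type := Fin n → (Fin (m.choose 2 + 1) →o ℕ)

/-- Borda`₀`-CB for `1`-bribery. -/
def BordaCBOne : Instance OnePrice → Prop :=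
  CB borda 0 fun {m n} _ _ => oneBribery m n

/-- Borda`₀`-CB for `$`-bribery. -/
def BordaCBDollar : Instance DollarPrice → Prop :=
  CB borda 0 fun {m _} _ p => dollarBribery m p

/-- Borda`₀`-CB for coalition-shift-bribery. -/
def BordaCBShift : Instance ShiftPrice → Prop :=
  CB borda 0 fun A s => coalitionShiftBribery A s

/-! ### Encoding of instances and polynomial time -/

open Computability (Γ')

/-- A natural number in binary, ended by a comma. -/
def encNat (k : ℕ) : List Γ' := Computability.encodingNatΓ'.encode k ++ [Γ'.comma]

/-- A string in brackets. -/
def block (l : List Γ') : List Γ' := Γ'.bra :: l ++ [Γ'.ket]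

/-- The concatenation of the strings `f 0, f 1, …, f (k - 1)`, in brackets. -/
def blockOf {k : ℕ} (f : Fin k → List Γ') : List Γ' := block (List.ofFn f).flatten

/-- An order, as the list of the (numbers of the) parties from top to bottom. -/
def encOrder {m : ℕ} (O : PrefOrder m) : List Γ' := blockOf fun r => encNat (O.symm r : ℕ)

/-- An instance, as a string: the characteristic vector of the coalition, the list of the
preference orders, numerator and denominator of the target support, the budget, and the prices. All
numbers are in binary. -/
def encInstance {Price : ℕ → ℕ → Type} (encPrice : {m n : ℕ} → Price m n → List Γ')
    (I : Instance Price) : List Γ' :=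
  blockOf (fun c : Fin I.m => [Γ'.bit (decide (c ∈ I.A))]) ++
  blockOf (fun i => encOrder (I.order i)) ++
  encNat I.φ.num.natAbs ++ encNat I.φ.den ++ encNat I.B ++ encPrice I.price

/-- There is nothing to encode for `1`-bribery. -/
def encOnePrice {m n : ℕ} (_ : OnePrice m n) : List Γ' := []

/-- The list of the prices of the voters. -/
def encDollarPrice {m n : ℕ} (p : DollarPrice m n) : List Γ' := blockOf fun i => encNat (p i)

/-- For every voter the table of all values of the price function. -/
def encShiftPrice {m n : ℕ} (s : ShiftPrice m n) : List Γ' :=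
  blockOf fun i => blockOf fun d => encNat (s i d)

/-- The decision problem `P` on the type `α`, with inputs encoded by `enc`, is solved by a
(multi-stack) Turing machine which outputs the correct answer within a number of steps that is
bounded by a polynomial in the length of the encoded input. -/
def SolvableInPolyTime {α : Type} (enc : α → List Γ') (P : α → Prop) : Prop :=
  ∃ f : α → Bool, (∀ a, f a = true ↔ P a) ∧
    Nonempty (Turing.TM2ComputableInPolyTime enc Computability.encodeBool f)

end CoalitionBribery

/-! A bribe cannot change the total number of Borda points. So the share of $C$ is always $1$, and
the target is a linear inequality for the points of the coalition. In a single order these points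
are a constant minus the number of gain pairs, i.e. pairs of a member $x$ and an outsider $y$ with
$y$ above $x$ (`bordaPoints_add_gain`). From a voter with $G$ gain pairs the coalition can thus gain
at most $G$ points. Exchanging a member with the outsider directly above it removes exactly one gain
pair. Hence every gain $g\le G$ is possible with at most $g$ swapped pairs and without any member
falling below an outsider (`exists_shift`); conversely a gain of $g$ needs at least $g$ swapped
pairs (`card_gainPairs_le`). The least cost of the gain $g$ is therefore $s_i(g)$ for
coalition-shift-bribery; for \$-bribery it is $0$ if $g=0$ and $p_i$ otherwise, and 1-bribery is the
case $p_i=1$.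

What remains is a multiple-choice knapsack problem (`cb_iff`). Its costs are binary numbers and may
be huge, but the total gain is at most $n\binom m2$, which is polynomial in the input length because
the orders are written out. A dynamic program therefore keeps the least cost for each total gain,
adds the voters one by one through min-plus convolution (`attains_costTable`), and finally looks for
an entry within the budget with enough gain (`search_iff`).

The time bound concerns an actual multi-stack machine. Structured stack programs are compiled to
such machines (`Runs.reach`, `machine_outputs`). Data are binary trees whose preorder serialisation
is self-delimiting, so that several trees can lie on one stack. `PT f` provides a program that
replaces the tree of `a` on top by the tree of `f a` in polynomial time and leaves everything
beneath it untouched. This class is closed under composition, pairing, case distinction, and folds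
whose intermediate results stay polynomially small (`PT.foldl`); the whole algorithm is built from
these operations. A parser turns the encoded instance into a tree (`parses_encInstance`), and
`solvableInPolyTime` joins the pieces. -/

namespace StackProgram

open Turing

/-! ### Structured stack programs and their compilation to Turing machines -/

/-- Structured programs which work on finitely many stacks. -/
inductive Prog {K : Type} (Γ : K → Type) : Type
  | skip : Prog Γ
  | push (k : K) (a : Γ k) : Prog Γ
  | pop (k : K) : Prog Γ
  | seq (p q : Prog Γ) : Prog Γ
  | ite (k : K) (t : Option (Γ k) → Bool) (p q : Prog Γ) : Prog Γ
  | loop (k : K) (t : Option (Γ k) → Bool) (p : Prog Γ) : Prog Γ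

variable {K : Type} [DecidableEq K] {Γ : K → Type}

/-- `Runs p S S' n`: the program `p` turns the stacks `S` into `S'` in at most `n` steps. -/
inductive Runs : Prog Γ → (∀ k, List (Γ k)) → (∀ k, List (Γ k)) → ℕ → Prop
  | skip (S) : Runs .skip S S 1
  | push (S k a) : Runs (.push k a) S (Function.update S k (a :: S k)) 1
  | pop (S k) : Runs (.pop k) S (Function.update S k (S k).tail) 1
  | seq {p q S S' S'' n n'} : Runs p S S' n → Runs q S' S'' n' → Runs (.seq p q) S S'' (n + n')
  | ite_true {k t p q S S' n} : t (S k).head? = true → Runs p S S' n →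
      Runs (.ite k t p q) S S' (n + 1)
  | ite_false {k t p q S S' n} : t (S k).head? = false → Runs q S S' n →
      Runs (.ite k t p q) S S' (n + 1)
  | loop_done {k t p S} : t (S k).head? = false → Runs (.loop k t p) S S 1
  | loop_step {k t p S S' S'' n n'} : t (S k).head? = true → Runs p S S' n →
      Runs (.loop k t p) S' S'' n' → Runs (.loop k t p) S S'' (n + n' + 1)
  | mono {p S S' n n'} : Runs p S S' n → n ≤ n' → Runs p S S' n'

/-- Each step pushes at most one symbol. This turns time bounds into size bounds for results. -/
theorem Runs.length_le {p : Prog Γ} {S S' : ∀ k, List (Γ k)} {n : ℕ} (h : Runs p S S' n) (k : K) :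
    (S' k).length ≤ (S k).length + n := by
  induction h with
  | skip => omega
  | push S k' a =>
    by_cases hk : k = k'
    · subst hk; simp
    · simp [Function.update_of_ne hk]
  | pop S k' =>
    by_cases hk : k = k'
    · subst hk; simp; omega
    · simp [Function.update_of_ne hk]
  | seq _ _ h1 h2 => omega
  | ite_true _ _ h => omega
  | ite_false _ _ h => omega
  | loop_done => omega
  | loop_step _ _ _ h1 h2 => omega
  | mono _ _ h => omega

/-- The labels of the machine for a program. -/
def Lab : Prog Γ → Type
  | .skip => Unit
  | .push _ _ => Unit
  | .pop _ => Unit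
  | .seq p q => Lab p ⊕ Lab q
  | .ite _ _ p q => Option (Lab p ⊕ Lab q)
  | .loop _ _ p => Option (Lab p)

/-- There are finitely many labels. -/
@[reducible]
def labFintype : (p : Prog Γ) → Fintype (Lab p)
  | .skip => inferInstanceAs (Fintype Unit)
  | .push _ _ => inferInstanceAs (Fintype Unit)
  | .pop _ => inferInstanceAs (Fintype Unit)
  | .seq p q => @instFintypeSum _ _ (labFintype p) (labFintype q)
  | .ite _ _ p q => @instFintypeOption _ (@instFintypeSum _ _ (labFintype p) (labFintype q))
  | .loop _ _ p => @instFintypeOption _ (labFintype p)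

/-- The label where a program starts. -/
def entry : (p : Prog Γ) → Lab p
  | .skip => ()
  | .push _ _ => ()
  | .pop _ => ()
  | .seq p _ => Sum.inl (entry p)
  | .ite _ _ _ _ => none
  | .loop _ _ _ => none

/-- The machine code of a program whose labels are renamed by `emb` and which continues at the label
`exit`. -/
def code {Λ : Type} : (p : Prog Γ) → (exit : Λ) → (emb : Lab p → Λ) → Lab p → TM2.Stmt Γ Λ Bool
  | .skip, exit, _, _ => .goto fun _ => exit
  | .push k a, exit, _, _ => .push k (fun _ => a) (.goto fun _ => exit)
  | .pop k, exit, _, _ => .pop k (fun v _ => v) (.goto fun _ => exit)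
  | .seq p q, exit, emb, l => match l with
    | Sum.inl l => code p (emb (Sum.inr (entry q))) (fun l => emb (Sum.inl l)) l
    | Sum.inr l => code q exit (fun l => emb (Sum.inr l)) l
  | .ite k t p q, exit, emb, l => match l with
    -- The machine's only internal memory is one Boolean, which carries the outcome of the test to
    -- the branch.
    | none => .peek k (fun _ a => t a) (.branch id
        (.goto fun _ => emb (some (Sum.inl (entry p))))
        (.goto fun _ => emb (some (Sum.inr (entry q)))))
    | some (Sum.inl l) => code p exit (fun l => emb (some (Sum.inl l))) l
    | some (Sum.inr l) => code q exit (fun l => emb (some (Sum.inr l))) l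
  | .loop k t p, exit, emb, l => match l with
    | none => .peek k (fun _ a => t a) (.branch id
        (.goto fun _ => emb (some (entry p))) (.goto fun _ => exit))
    | some l => code p (emb none) (fun l => emb (some l)) l

/-- The machine `M` gets from one configuration to another in at most `n` steps. -/
def Reach {Λ : Type} (M : Λ → TM2.Stmt Γ Λ Bool) (c c' : TM2.Cfg Γ Λ Bool) (n : ℕ) : Prop :=
  ∃ j ≤ n, (flip bind (TM2.step M))^[j] (some c) = some c'

theorem Reach.trans {Λ : Type} {M : Λ → TM2.Stmt Γ Λ Bool} {c c' c'' : TM2.Cfg Γ Λ Bool}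
    {n n' : ℕ} (h : Reach M c c' n) (h' : Reach M c' c'' n') : Reach M c c'' (n + n') := by
  obtain ⟨j, hj, e⟩ := h
  obtain ⟨j', hj', e'⟩ := h'
  refine ⟨j' + j, by omega, ?_⟩
  rw [Function.iterate_add_apply, e, e']

theorem Reach.of_step {Λ : Type} {M : Λ → TM2.Stmt Γ Λ Bool} {c c' : TM2.Cfg Γ Λ Bool}
    (h : TM2.step M c = some c') : Reach M c c' 1 :=
  ⟨1, le_rfl, by simpa [flip] using h⟩

/-- Correctness of the compilation, by induction on the run. The exit label and the renaming of
labels are universally quantified because a subprogram sits inside `M` with its own exit and its own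
renaming. The final memory is existential since tests overwrite it. -/
theorem Runs.reach {Λ : Type} (M : Λ → TM2.Stmt Γ Λ Bool) {p : Prog Γ} {S S' : ∀ k, List (Γ k)}
    {n : ℕ} (h : Runs p S S' n) : ∀ (exit : Λ) (emb : Lab p → Λ),
    (∀ l, M (emb l) = code p exit emb l) → ∀ v, ∃ v',
      Reach M ⟨some (emb (entry p)), v, S⟩ ⟨some exit, v', S'⟩ n := by
  induction h with
  | skip S =>
    intro exit emb hM v
    exact ⟨v, .of_step (by simp [TM2.step, hM, code, TM2.stepAux])⟩
  | push S k a =>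
    intro exit emb hM v
    exact ⟨v, .of_step (by simp [TM2.step, hM, code, TM2.stepAux])⟩
  | pop S k =>
    intro exit emb hM v
    exact ⟨v, .of_step (by simp [TM2.step, hM, code, TM2.stepAux])⟩
  | @seq p q S S' S'' n n' _ _ h1 h2 =>
    intro exit emb hM v
    obtain ⟨v1, r1⟩ := h1 (emb (Sum.inr (entry q))) (fun l => emb (Sum.inl l))
      (fun l => hM (Sum.inl l)) v
    obtain ⟨v2, r2⟩ := h2 exit (fun l => emb (Sum.inr l)) (fun l => hM (Sum.inr l)) v1
    exact ⟨v2, r1.trans r2⟩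
  | @ite_true k t p q S S' n ht _ h1 =>
    intro exit emb hM v
    obtain ⟨v1, r1⟩ := h1 exit (fun l => emb (some (Sum.inl l)))
      (fun l => hM (some (Sum.inl l))) true
    refine ⟨v1, ?_⟩
    rw [add_comm]
    refine Reach.trans (.of_step ?_) r1
    simp only [TM2.step, hM]
    change some (cond (t (S k).head?) _ _) = _
    simp [TM2.stepAux, ht]
  | @ite_false k t p q S S' n ht _ h1 =>
    intro exit emb hM v
    obtain ⟨v1, r1⟩ := h1 exit (fun l => emb (some (Sum.inr l)))
      (fun l => hM (some (Sum.inr l))) false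
    refine ⟨v1, ?_⟩
    rw [add_comm]
    refine Reach.trans (.of_step ?_) r1
    simp only [TM2.step, hM]
    change some (cond (t (S k).head?) _ _) = _
    simp [TM2.stepAux, ht]
  | @loop_done k t p S ht =>
    intro exit emb hM v
    refine ⟨false, .of_step ?_⟩
    simp only [TM2.step, hM]
    change some (cond (t (S k).head?) _ _) = _
    simp [TM2.stepAux, ht]
  | @loop_step k t p S S' S'' n n' ht _ _ h1 h2 =>
    intro exit emb hM v
    obtain ⟨v1, r1⟩ := h1 (emb none) (fun l => emb (some l)) (fun l => hM (some l)) true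
    obtain ⟨v2, r2⟩ := h2 exit emb hM v1
    refine ⟨v2, ?_⟩
    rw [add_comm]
    refine Reach.trans (.of_step ?_) (r1.trans r2)
    simp only [TM2.step, hM]
    change some (cond (t (S k).head?) _ _) = _
    simp [TM2.stepAux, ht]
  | mono _ hle h =>
    intro exit emb hM v
    obtain ⟨v1, j, hj, e⟩ := h exit emb hM v
    exact ⟨v1, j, hj.trans hle, e⟩

/-- The Turing machine for a program, with input stack `k₀` and output stack `k₁`. -/
def machine [Fintype K] (k₀ k₁ : K) [Fintype (Γ k₀)] (p : Prog Γ) : FinTM2 where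
  K := K
  k₀ := k₀
  k₁ := k₁
  Γ := Γ
  Λ := Option (Lab p)
  main := some (entry p)
  ΛFin := @instFintypeOption _ (labFintype p)
  σ := Bool
  initialState := false
  m := fun l => match l with
    -- The final configuration required by `haltList` has the initial memory, so the Boolean is
    -- reset before halting.
    | none => .load (fun _ => false) .halt
    | some l => code p none some l

theorem dite_eq_update (k₀ : K) (s : List (Γ k₀)) (k : K) :
    (if h : k = k₀ then (by rw [h]; exact s) else []) =
      Function.update (fun k => ([] : List (Γ k))) k₀ s k := by
  by_cases hk : k = k₀
  · subst hk
    simp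
  · simp [hk]

theorem machine_outputs [Fintype K] (k₀ k₁ : K) [Fintype (Γ k₀)] (p : Prog Γ)
    (s : List (Γ k₀)) (s' : List (Γ k₁)) (n : ℕ)
    (h : Runs p (Function.update (fun _ => []) k₀ s) (Function.update (fun _ => []) k₁ s') n) :
    Nonempty (TM2OutputsInTime (machine k₀ k₁ p) s (some s') (n + 1)) := by
  obtain ⟨v, r⟩ := h.reach (machine k₀ k₁ p).m none some (fun l => rfl) false
  -- The extra step in `n + 1` is the one at the halting label.
  have r' : Reach (machine k₀ k₁ p).m ⟨some none, v, Function.update (fun _ => []) k₁ s'⟩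
      ⟨none, false, Function.update (fun _ => []) k₁ s'⟩ 1 :=
    .of_step (by simp [TM2.step, machine, TM2.stepAux])
  obtain ⟨j, hj, e⟩ := r.trans r'
  have hin : initList (machine k₀ k₁ p) s =
      ⟨some (some (entry p)), false, Function.update (fun _ => []) k₀ s⟩ := by
    unfold initList
    congr 1
    funext k
    exact dite_eq_update k₀ _ k
  have hout : haltList (machine k₀ k₁ p) s' =
      ⟨none, false, Function.update (fun _ => []) k₁ s'⟩ := by
    unfold haltList
    congr 1
    funext k
    exact dite_eq_update k₁ _ k
  refine ⟨⟨⟨j, ?_⟩, hj⟩⟩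
  rw [hin]
  exact e.trans (congrArg some hout.symm)

end StackProgram

namespace StackProgram

open Computability (Γ')

/-! ### Programs on serialised binary trees -/

/-- Binary trees, the universal data type. -/
inductive D : Type
  | nil : D
  | cons (a b : D) : D

/-- The preorder serialisation of a tree. -/
def D.ser : D → List Bool
  | .nil => [false]
  | .cons a b => true :: (a.ser ++ b.ser)

/-- The stacks: a main stack, two auxiliary ones, a counter, the input, the reversed input and the
output. -/
inductive Stk : Type
  | main
  | aux (b : Bool)
  | cnt
  | inp
  | rev
  | out
  deriving DecidableEq, Fintype

/-- The alphabets of the stacks. -/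
@[reducible] def Alph : Stk → Type
  | .main => Bool
  | .aux _ => Bool
  | .cnt => Unit
  | .inp => Γ'
  | .rev => Γ'
  | .out => Bool

/-- The stacks with given contents. -/
def st (m : List Bool) (x : Bool → List Bool) (c : List Unit) (i r : List Γ') (o : List Bool) :
    ∀ k, List (Alph k)
  | .main => m
  | .aux b => x b
  | .cnt => c
  | .inp => i
  | .rev => r
  | .out => o

section st
variable (m : List Bool) (x : Bool → List Bool) (c : List Unit) (i r : List Γ') (o : List Bool)

@[simp] theorem st_main : st m x c i r o .main = m := rfl
@[simp] theorem st_aux (b : Bool) : st m x c i r o (.aux b) = x b := rfl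
@[simp] theorem st_cnt : st m x c i r o .cnt = c := rfl
@[simp] theorem st_inp : st m x c i r o .inp = i := rfl
@[simp] theorem st_rev : st m x c i r o .rev = r := rfl
@[simp] theorem st_out : st m x c i r o .out = o := rfl

@[simp] theorem update_main (y : List Bool) :
    Function.update (st m x c i r o) .main y = st y x c i r o := by
  funext k; cases k <;> rfl

@[simp] theorem update_aux (b : Bool) (y : List Bool) :
    Function.update (st m x c i r o) (.aux b) y = st m (Function.update x b y) c i r o := by
  funext k
  cases k with
  | aux b' =>
    by_cases h : b' = b
    · subst h; simp
    · have : Stk.aux b' ≠ Stk.aux b := by simpa using h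
      simp [Function.update_of_ne this, Function.update_of_ne h]
  | _ => rfl

@[simp] theorem update_cnt (y : List Unit) :
    Function.update (st m x c i r o) .cnt y = st m x y i r o := by
  funext k; cases k <;> rfl

@[simp] theorem update_inp (y : List Γ') :
    Function.update (st m x c i r o) .inp y = st m x c y r o := by
  funext k; cases k <;> rfl

@[simp] theorem update_rev (y : List Γ') :
    Function.update (st m x c i r o) .rev y = st m x c i y o := by
  funext k; cases k <;> rfl

@[simp] theorem update_out (y : List Bool) :
    Function.update (st m x c i r o) .out y = st m x c i r y := by
  funext k; cases k <;> rfl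

end st

section runs
variable {K : Type} [DecidableEq K] {Γ : K → Type} {S S' : ∀ k, List (Γ k)}

theorem Runs.push_eq {k : K} {a : Γ k} (h : Function.update S k (a :: S k) = S') :
    Runs (.push k a) S S' 1 := h ▸ Runs.push S k a

theorem Runs.pop_eq {k : K} (h : Function.update S k (S k).tail = S') :
    Runs (.pop k) S S' 1 := h ▸ Runs.pop S k

theorem Runs.conv {S'' : ∀ k, List (Γ k)} {p : Prog Γ} {n n' : ℕ} (h : Runs p S S' n)
    (hS : S' = S'') (hn : n ≤ n') : Runs p S S'' n' := hS ▸ h.mono hn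

end runs

/-- Move the tree on top of the main stack to an auxiliary stack, counting how many subtrees are
still to be read. -/
def moveLoop (b : Bool) : Prog Alph :=
  .loop .cnt Option.isSome (.ite .main (· = some true)
    (.seq (.pop .main) (.seq (.push (.aux b) true) (.push .cnt ())))
    (.seq (.pop .main) (.seq (.push (.aux b) false) (.pop .cnt))))

variable {i r : List Γ'} {o : List Bool}

/-- The counter stack has one unit per pending subtree: `true` (a `cons`) replaces one pending
subtree by two, `false` (a `nil`) finishes one. The statement takes the rest of the run as a
hypothesis, so that the induction hypotheses for the two children can be chained within a single
loop. -/
theorem moveLoop_runs (b : Bool) (d : D) : ∀ (m : List Bool) (x : Bool → List Bool) (c : List Unit)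
    (S' : ∀ k, List (Alph k)) (n : ℕ),
    Runs (moveLoop b) (st m (Function.update x b (d.ser.reverse ++ x b)) c i r o) S' n →
    Runs (moveLoop b) (st (d.ser ++ m) x (() :: c) i r o) S' (n + 5 * d.ser.length) := by
  induction d with
  | nil =>
    intro m x c S' n h
    refine Runs.mono (Runs.loop_step (n := 4) (n' := n) (by simp) (.ite_false (n := 3)
      (by simp [D.ser]) (.seq (n := 1)
      (n' := 2) (.pop_eq rfl) (.seq (n := 1) (n' := 1) (.push_eq rfl) (.pop_eq rfl)))) ?_) ?_
    · simpa [D.ser, moveLoop] using h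
    · simp [D.ser]; omega
  | cons d e hd he =>
    intro m x c S' n h
    refine Runs.mono (Runs.loop_step (n := 4) (n' := n + 5 * e.ser.length + 5 * d.ser.length)
      (by simp) (.ite_true (n := 3) (by simp [D.ser]) (.seq (n := 1)
      (n' := 2) (.pop_eq rfl) (.seq (n := 1) (n' := 1) (.push_eq rfl) (.push_eq rfl)))) ?_) ?_
    · have := hd (e.ser ++ m) (Function.update x b (true :: x b)) (() :: c) S' _
        (he m _ c S' n (by simpa [D.ser] using h))
      simpa [D.ser, moveLoop] using this
    · simp [D.ser]; omega

/-- Move the tree on top of the main stack to an auxiliary stack. -/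
def move (b : Bool) : Prog Alph := .seq (.push .cnt ()) (moveLoop b)

theorem move_runs (b : Bool) (d : D) (m : List Bool) (x : Bool → List Bool) :
    Runs (move b) (st (d.ser ++ m) x [] i r o)
      (st m (Function.update x b (d.ser.reverse ++ x b)) [] i r o) (5 * d.ser.length + 2) := by
  refine Runs.mono (Runs.seq (n := 1) (n' := 1 + 5 * d.ser.length) (.push_eq rfl) ?_) (by omega)
  have := moveLoop_runs (i := i) (r := r) (o := o) b d m x [] _ 1 (.loop_done (by simp))
  simpa using this

/-- Empty an auxiliary stack, running `p y` after the symbol `y` was popped. -/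
def drain (b : Bool) (p : Bool → Prog Alph) : Prog Alph :=
  .loop (.aux b) Option.isSome (.ite (.aux b) (· = some true)
    (.seq (.pop (.aux b)) (p true)) (.seq (.pop (.aux b)) (p false)))

theorem drain_done {b : Bool} {p : Bool → Prog Alph} {m : List Bool} {x : Bool → List Bool}
    (h : x b = []) :
    Runs (drain b p) (st m x [] i r o) (st m (Function.update x b []) [] i r o) 1 := by
  have := Runs.loop_done (k := Stk.aux b) (t := Option.isSome) (S := st m x [] i r o)
    (p := .ite (.aux b) (· = some true)
      (.seq (.pop (.aux b)) (p true)) (.seq (.pop (.aux b)) (p false))) (by simp [h])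
  rwa [← h, Function.update_eq_self]

theorem drain_step {b y : Bool} {p : Bool → Prog Alph} {m l : List Bool} {x : Bool → List Bool}
    {S S' : ∀ k, List (Alph k)} {n n' : ℕ} (h : x b = y :: l)
    (hp : Runs (p y) (st m (Function.update x b l) [] i r o) S n)
    (hd : Runs (drain b p) S S' n') : Runs (drain b p) (st m x [] i r o) S' (n + n' + 3) := by
  refine Runs.mono (Runs.loop_step (n := n + 2) (by simp [h]) ?_ hd) (by omega)
  have h1 : Runs (.seq (.pop (.aux b)) (p y)) (st m x [] i r o) S (1 + n) :=
    Runs.seq (.pop_eq (S' := st m (Function.update x b l) [] i r o) (by simp [h])) hp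
  cases y
  · exact (Runs.ite_false (by simp [h]) h1).mono (by omega)
  · exact (Runs.ite_true (by simp [h]) h1).mono (by omega)

/-- Move an auxiliary stack back to the main stack. -/
def unload (b : Bool) : Prog Alph := drain b fun y => .push .main y

theorem unload_runs (b : Bool) (l : List Bool) : ∀ (m : List Bool) (x : Bool → List Bool),
    x b = l → Runs (unload b) (st m x [] i r o)
      (st (l.reverse ++ m) (Function.update x b []) [] i r o) (4 * l.length + 1) := by
  induction l with
  | nil => exact fun m x h => drain_done h
  | cons y l ih =>
    exact fun m x h => Runs.conv (drain_step h (S := st (y :: m) (Function.update x b l) [] i r o)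
      (.push_eq (by simp)) (ih (y :: m) (Function.update x b l) (by simp))) (by simp) (by simp; omega)

/-- Clear an auxiliary stack. -/
def clear (b : Bool) : Prog Alph := drain b fun _ => .skip

theorem clear_runs (b : Bool) (l : List Bool) : ∀ (m : List Bool) (x : Bool → List Bool),
    x b = l → Runs (clear b) (st m x [] i r o)
      (st m (Function.update x b []) [] i r o) (4 * l.length + 1) := by
  induction l with
  | nil => exact fun m x h => drain_done h
  | cons y l ih =>
    exact fun m x h => Runs.conv (drain_step h (.skip _) (ih m (Function.update x b l)
      (by simp))) (by simp) (by simp; omega)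

/-- Move an auxiliary stack to the main stack and to the other auxiliary stack. -/
def unloadCopy (b : Bool) : Prog Alph :=
  drain b fun y => .seq (.push .main y) (.push (.aux !b) y)

theorem update_update_not (x : Bool → List Bool) (b : Bool) (l u v : List Bool) :
    Function.update (Function.update (Function.update (Function.update x b l) (!b) u) b []) (!b) v =
      Function.update (Function.update x b []) (!b) v := by
  funext z
  cases b <;> cases z <;> simp

theorem unloadCopy_runs (b : Bool) (l : List Bool) : ∀ (m : List Bool) (x : Bool → List Bool),
    x b = l → Runs (unloadCopy b) (st m x [] i r o) (st (l.reverse ++ m)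
      (Function.update (Function.update x b []) (!b) (l.reverse ++ x (!b))) [] i r o)
      (5 * l.length + 1) := by
  induction l with
  | nil => exact fun m x h => (drain_done h).conv (by
      rw [List.reverse_nil, List.nil_append, eq_comm]
      congr 1
      simp) le_rfl
  | cons y l ih =>
    intro m x h
    have := ih (y :: m) (Function.update (Function.update x b l) (!b) (y :: x !b))
      (by cases b <;> simp)
    refine Runs.conv (drain_step h (S := st (y :: m) (Function.update (Function.update x b l) (!b)
      (y :: x !b)) [] i r o) (.seq (n := 1) (n' := 1) (.push_eq rfl) (.push_eq (by simp))) this)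
      ?_ ?_
    · simp [update_update_not]
    · simp; omega

/-- Move an auxiliary stack to the other one. -/
def transfer (b : Bool) : Prog Alph := drain b fun y => .push (.aux !b) y

theorem transfer_runs (b : Bool) (l : List Bool) : ∀ (m : List Bool) (x : Bool → List Bool),
    x b = l → Runs (transfer b) (st m x [] i r o) (st m
      (Function.update (Function.update x b []) (!b) (l.reverse ++ x (!b))) [] i r o)
      (4 * l.length + 1) := by
  induction l with
  | nil => exact fun m x h => (drain_done h).conv (by
      rw [List.reverse_nil, List.nil_append, eq_comm]
      congr 1
      simp) le_rfl
  | cons y l ih =>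
    intro m x h
    have := ih m (Function.update (Function.update x b l) (!b) (y :: x !b)) (by cases b <;> simp)
    refine Runs.conv (drain_step h (S := st m (Function.update (Function.update x b l) (!b)
      (y :: x !b)) [] i r o) (.push_eq (by simp)) this) ?_ ?_
    · simp [update_update_not]
    · simp; omega

/-- The stacks which are all empty except for the main one. -/
abbrev mst (m : List Bool) : ∀ k, List (Alph k) := st m (fun _ => []) [] [] [] []

/-- Remove the tree on top of the main stack. -/
def drop : Prog Alph := .seq (move true) (clear true)

theorem drop_runs (d : D) (m : List Bool) :
    Runs drop (mst (d.ser ++ m)) (mst m) (9 * d.ser.length + 3) := by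
  refine Runs.conv (Runs.seq (move_runs true d m _) (clear_runs true _ m _ rfl)) ?_ ?_
  · congr 1
    funext z
    cases z <;> simp
  · simp; omega

/-- Exchange the two trees on top of the main stack. -/
def swap : Prog Alph :=
  .seq (move true) (.seq (move false) (.seq (unload true) (unload false)))

theorem swap_runs (d e : D) (m : List Bool) :
    Runs swap (mst (d.ser ++ (e.ser ++ m))) (mst (e.ser ++ (d.ser ++ m)))
      (9 * d.ser.length + 9 * e.ser.length + 6) := by
  refine Runs.conv (Runs.seq (move_runs true d _ _) (Runs.seq (move_runs false e m _)
    (Runs.seq (unload_runs true _ m _ rfl) (unload_runs false _ _ _ rfl)))) ?_ ?_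
  · congr 1
    · simp
    · funext z
      cases z <;> simp
  · simp; omega

/-- Duplicate the tree on top of the main stack. -/
def dup : Prog Alph :=
  .seq (move true) (.seq (unloadCopy true) (.seq (transfer false) (unload true)))

/-- `unloadCopy` leaves its copy unreversed on the second auxiliary stack; `transfer` reverses it so
that `unload` restores the tree. -/
theorem dup_runs (d : D) (m : List Bool) :
    Runs dup (mst (d.ser ++ m)) (mst (d.ser ++ (d.ser ++ m))) (18 * d.ser.length + 5) := by
  refine Runs.conv (Runs.seq (move_runs true d _ _) (Runs.seq (unloadCopy_runs true _ m _ rfl)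
    (Runs.seq (transfer_runs false _ _ _ rfl) (unload_runs true _ _ _ rfl)))) ?_ ?_
  · congr 1
    · simp
    · funext z
      cases z <;> simp
  · simp; omega

end StackProgram

namespace StackProgram

/-! ### Functions which are computable in polynomial time -/

/-- Types whose elements are represented by trees. -/
class Enc (α : Type) where
  /-- the tree which represents an element -/
  enc : α → D

open Enc

/-- The length of the representation. -/
def size {α : Type} [Enc α] (a : α) : ℕ := (enc a).ser.length

instance : Enc Unit := ⟨fun _ => .nil⟩
instance : Enc Bool := ⟨fun b => if b then .cons .nil .nil else .nil⟩

section
variable {α β γ δ : Type} [Enc α] [Enc β] [Enc γ] [Enc δ]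

instance : Enc (α × β) := ⟨fun x => .cons (enc x.1) (enc x.2)⟩

instance : Enc (Option α) := ⟨fun o => match o with
  | none => .nil
  | some a => .cons .nil (enc a)⟩

instance : Enc (List α) := ⟨fun l => l.foldr (fun a d => .cons (enc a) d) .nil⟩

theorem enc_true : enc true = D.cons .nil .nil := rfl
theorem enc_false : enc false = D.nil := rfl
theorem enc_unit (u : Unit) : enc u = D.nil := rfl
theorem enc_mk (a : α) (b : β) : enc (a, b) = D.cons (enc a) (enc b) := rfl
theorem enc_none : enc (none : Option α) = D.nil := rfl
theorem enc_some (a : α) : enc (some a) = D.cons .nil (enc a) := rfl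
theorem enc_nil : enc ([] : List α) = D.nil := rfl
theorem enc_cons (a : α) (l : List α) : enc (a :: l) = D.cons (enc a) (enc l) := rfl

@[simp] theorem size_true : size true = 3 := rfl
@[simp] theorem size_false : size false = 1 := rfl
theorem size_bool_le (b : Bool) : size b ≤ 3 := by cases b <;> simp
@[simp] theorem size_unit (u : Unit) : size u = 1 := rfl
@[simp] theorem size_mk (a : α) (b : β) : size (a, b) = size a + size b + 1 := by
  simp [size, enc_mk, D.ser]
@[simp] theorem size_none : size (none : Option α) = 1 := rfl
@[simp] theorem size_some (a : α) : size (some a) = size a + 2 := by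
  simp [size, enc_some, D.ser]
@[simp] theorem size_nil : size ([] : List α) = 1 := rfl
@[simp] theorem size_cons (a : α) (l : List α) : size (a :: l) = size a + size l + 1 := by
  simp [size, enc_cons, D.ser]

theorem size_append (l l' : List α) : size (l ++ l') + 1 = size l + size l' := by
  induction l with
  | nil => simp [add_comm]
  | cons a l ih => simp; omega

theorem size_prefix {l l' : List α} (h : l' <+: l) : size l' ≤ size l := by
  obtain ⟨m, rfl⟩ := h
  have := size_append l' m
  have : 1 ≤ size m := by cases m <;> simp
  omega

theorem size_mem {l : List α} {a : α} (h : a ∈ l) : size a ≤ size l := by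
  induction l with
  | nil => simp at h
  | cons b l ih =>
    rcases List.mem_cons.1 h with rfl | h
    · simp; omega
    · have := ih h; simp; omega

theorem length_le_size (l : List α) : l.length ≤ size l := by
  induction l with
  | nil => simp
  | cons b l ih => simp; omega

theorem eval_mono (P : Polynomial ℕ) {m n : ℕ} (h : m ≤ n) : P.eval m ≤ P.eval n := by
  rw [Polynomial.eval_eq_sum, Polynomial.eval_eq_sum, Polynomial.sum, Polynomial.sum]
  gcongr

/-- The function `f` can be computed in polynomial time. -/
@[fun_prop]
def PT (f : α → β) : Prop :=
  ∃ (p : Prog Alph) (P : Polynomial ℕ), ∀ a m,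
    Runs p (mst ((enc a).ser ++ m)) (mst ((enc (f a)).ser ++ m)) (P.eval (size a))

/-- The output cannot exceed the input by more symbols than there are steps. Every composition of
time bounds relies on this. -/
theorem PT.size_le {f : α → β} (hf : PT f) :
    ∃ P : Polynomial ℕ, ∀ a, size (f a) ≤ P.eval (size a) := by
  obtain ⟨p, P, h⟩ := hf
  refine ⟨P + Polynomial.X, fun a => ?_⟩
  have := (h a []).length_le .main
  simp only [List.append_nil, st_main] at this
  simp only [Polynomial.eval_add, Polynomial.eval_X, size] at this ⊢
  omega

/-- Nothing has to be done if the tree stays the same. For example, a pair of a head and a tail is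
already the tree of a nonempty list. -/
theorem PT.of_enc_eq {f : α → β} (h : ∀ a, enc (f a) = enc a) : PT f :=
  ⟨.skip, 1, fun a m => by
    rw [h]
    exact (Runs.skip _).mono (by simp)⟩

@[fun_prop]
theorem PT.id : PT (fun a : α => a) := .of_enc_eq fun _ => rfl

@[fun_prop]
theorem PT.comp {g : β → γ} {f : α → β} (hg : PT g) (hf : PT f) : PT (fun a => g (f a)) := by
  obtain ⟨F, hF⟩ := hf.size_le
  obtain ⟨p, P, h⟩ := hf
  obtain ⟨q, Q, h'⟩ := hg
  refine ⟨.seq p q, P + Q.comp F, fun a m => (Runs.seq (h a m) (h' _ m)).mono ?_⟩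
  simp only [Polynomial.eval_add, Polynomial.eval_comp]
  have := eval_mono Q (hF a)
  omega

@[fun_prop]
theorem PT.mk {f : α → β} {g : α → γ} (hf : PT f) (hg : PT g) : PT (fun a => (f a, g a)) := by
  obtain ⟨F, hF⟩ := hf.size_le
  obtain ⟨G, hG⟩ := hg.size_le
  obtain ⟨p, P, h⟩ := hf
  obtain ⟨q, Q, h'⟩ := hg
  -- The argument is duplicated and the two copies are consumed by `p` and `q`; the final `true` is
  -- the root that joins the two results.
  refine ⟨.seq dup (.seq p (.seq swap (.seq q (.seq swap (.push .main true))))),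
    27 * Polynomial.X + P + Q + 18 * F + 9 * G + 18, fun a m => ?_⟩
  refine Runs.conv (Runs.seq (dup_runs _ _) (Runs.seq (h _ _) (Runs.seq (swap_runs _ _ _)
    (Runs.seq (h' _ _) (Runs.seq (swap_runs _ _ _) (Runs.push_eq rfl)))))) ?_ ?_
  · simp [enc_mk, D.ser]
  · have h1 := hF a
    have h2 := hG a
    simp only [size] at h1 h2
    simp [size]
    omega

theorem PT.nil (f : α → β) (hf : ∀ a, enc (f a) = D.nil) : PT f := by
  refine ⟨.seq drop (.push .main false), 9 * Polynomial.X + 4, fun a m => ?_⟩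
  refine Runs.conv (Runs.seq (drop_runs _ _) (Runs.push_eq rfl)) ?_ ?_
  · simp [hf, D.ser]
  · simp [size]

@[fun_prop]
theorem PT.const (b : β) : PT (fun _ : α => b) := by
  -- Only the tree of the constant matters, so trees are taken to encode themselves and the tree is
  -- built by induction.
  suffices h : ∀ d : D, @PT α D _ ⟨fun d => d⟩ (fun _ => d) by
    obtain ⟨p, P, h⟩ := h (enc b)
    exact ⟨p, P, h⟩
  intro d
  let _ : Enc D := ⟨fun d => d⟩
  induction d with
  | nil => exact PT.nil _ fun _ => rfl
  | cons d e hd he =>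
    obtain ⟨p, P, h⟩ := hd.mk he
    exact ⟨p, P, h⟩

theorem runs_pop_main (y : Bool) (m : List Bool) : Runs (.pop .main) (mst (y :: m)) (mst m) 1 :=
  .pop_eq (by simp)

theorem runs_push_main (y : Bool) (m : List Bool) : Runs (.push .main y) (mst m) (mst (y :: m)) 1 :=
  .push_eq (by simp)

@[fun_prop]
theorem PT.fst {f : α → β × γ} (hf : PT f) : PT (fun a => (f a).1) := by
  refine PT.comp (g := Prod.fst) ⟨.seq (.pop .main) (.seq swap drop),
    18 * Polynomial.X + 10, fun x m => ?_⟩ hf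
  obtain ⟨b, c⟩ := x
  refine Runs.conv (Runs.seq (S' := mst ((enc b).ser ++ ((enc c).ser ++ m))) (n := 1) ?_
    (Runs.seq (swap_runs _ _ _) (drop_runs _ _))) rfl ?_
  · exact .pop_eq (by simp [enc_mk, D.ser])
  · simp [size, enc_mk, D.ser]
    omega

@[fun_prop]
theorem PT.snd {f : α → β × γ} (hf : PT f) : PT (fun a => (f a).2) := by
  refine PT.comp (g := Prod.snd) ⟨.seq (.pop .main) drop,
    9 * Polynomial.X + 4, fun x m => ?_⟩ hf
  obtain ⟨b, c⟩ := x
  refine Runs.conv (Runs.seq (S' := mst ((enc b).ser ++ ((enc c).ser ++ m))) (n := 1) ?_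
    (drop_runs _ _)) rfl ?_
  · exact .pop_eq (by simp [enc_mk, D.ser])
  · simp [size, enc_mk, D.ser]
    omega

/-- A case distinction on the tree which represents `h a`. -/
theorem PT.case {h : α → β} {k f : α → γ} {g : δ → γ} (hh : PT h) (hf : PT f) (hg : PT g)
    (hnil : ∀ a, enc (h a) = .nil → k a = f a)
    (hcons : ∀ a, enc (h a) ≠ .nil → ∃ d, enc d = .cons (enc a) (enc (h a)) ∧ k a = g d) :
    PT k := by
  obtain ⟨H, hH⟩ := hh.size_le
  obtain ⟨p, P, hp⟩ := hh
  obtain ⟨q, Q, hq⟩ := hf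
  obtain ⟨r, R, hr⟩ := hg
  -- If the tested tree is a `cons`, then `swap` and the pushed root form the pair of `a` and `h a`,
  -- on which `r` runs. The type `δ` is chosen by the caller so that this pair is the encoding of
  -- one of its elements.
  refine ⟨.seq dup (.seq p (.ite .main (· = some true)
    (.seq swap (.seq (.push .main true) r)) (.seq (.pop .main) q))),
    27 * Polynomial.X + P + 9 * H + Q + R.comp (Polynomial.X + H + 1) + 20, fun a m => ?_⟩
  have h1 := hH a
  by_cases e : enc (h a) = .nil
  · have : Runs (.ite .main (· = some true) (.seq swap (.seq (.push .main true) r))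
        (.seq (.pop .main) q)) (mst ((enc (h a)).ser ++ ((enc a).ser ++ m)))
        (mst ((enc (k a)).ser ++ m)) ((1 + Q.eval (size a)) + 1) := by
      refine .ite_false (by simp [e, D.ser]) (Runs.seq (S' := mst ((enc a).ser ++ m)) ?_ ?_)
      · rw [e]; exact runs_pop_main _ _
      · rw [hnil a e]; exact hq a m
    refine (Runs.seq (dup_runs _ _) (Runs.seq (hp _ _) this)).mono ?_
    simp [size]
    omega
  · obtain ⟨d, hd, hk⟩ := hcons a e
    have : Runs (.ite .main (· = some true) (.seq swap (.seq (.push .main true) r))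
        (.seq (.pop .main) q)) (mst ((enc (h a)).ser ++ ((enc a).ser ++ m)))
        (mst ((enc (k a)).ser ++ m))
        ((9 * (enc (h a)).ser.length + 9 * (enc a).ser.length + 6) + (1 + R.eval (size d)) + 1) := by
      refine .ite_true ?_ (Runs.seq (swap_runs _ _ _) (Runs.seq (runs_push_main _ _) ?_))
      · cases e' : enc (h a) with
        | nil => exact absurd e' e
        | cons u v => simp [D.ser]
      · rw [hk]
        have := hr d m
        rw [hd] at this
        simpa [D.ser] using this
    refine (Runs.seq (dup_runs _ _) (Runs.seq (hp _ _) this)).mono ?_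
    have h2 : size d ≤ size a + H.eval (size a) + 1 := by
      simp only [size, hd, D.ser] at h1 ⊢
      simp
      omega
    have h3 := eval_mono R h2
    simp only [size] at h1 h3
    simp [size]
    omega

@[fun_prop]
theorem PT.cond {c : α → Bool} {f g : α → β} (hc : PT c) (hf : PT f) (hg : PT g) :
    PT (fun a => bif c a then f a else g a) := by
  -- `true` has the same tree as a pair of units.
  refine PT.case (δ := α × (Unit × Unit)) hc hg (hf.comp (f := Prod.fst) (by fun_prop)) ?_ ?_
  · intro a h
    cases e : c a with
    | false => rfl
    | true => rw [e] at h; simp [enc_true] at h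
  · intro a h
    cases e : c a with
    | false => rw [e] at h; simp [enc_false] at h
    | true => exact ⟨(a, ((), ())), rfl, rfl⟩

theorem PT.option_elim {o : α → Option β} {f : α → γ} {g : α × β → γ} (ho : PT o) (hf : PT f)
    (hg : PT g) : PT (fun a => (o a).elim (f a) fun b => g (a, b)) := by
  refine PT.case (δ := α × (Unit × β)) (g := fun x => g (x.1, x.2.2)) ho hf (by fun_prop) ?_ ?_
  · intro a h
    cases e : o a with
    | none => rfl
    | some b => rw [e] at h; simp [enc_some] at h
  · intro a h
    cases e : o a with
    | none => rw [e] at h; simp [enc_none] at h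
    | some b => exact ⟨(a, ((), b)), rfl, rfl⟩

theorem PT.list_cases {l : α → List β} {k : α → γ} {f : α → γ} {g : α × (β × List β) → γ}
    (hl : PT l) (hf : PT f) (hg : PT g) (hnil : ∀ a, l a = [] → k a = f a)
    (hcons : ∀ a b t, l a = b :: t → k a = g (a, (b, t))) : PT k := by
  refine PT.case (δ := α × (β × List β)) hl hf hg ?_ ?_
  · intro a h
    cases e : l a with
    | nil => exact hnil a e
    | cons b t => rw [e] at h; simp [enc_cons] at h
  · intro a h
    cases e : l a with
    | nil => rw [e] at h; simp [enc_nil] at h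
    | cons b t => exact ⟨(a, (b, t)), rfl, hcons a b t e⟩

@[fun_prop]
theorem PT.some {f : α → β} (hf : PT f) : PT (fun a => some (f a)) := by
  have : PT (fun x : Unit × β => Option.some x.2) := .of_enc_eq fun _ => rfl
  exact this.comp (f := fun a => ((), f a)) (by fun_prop)

@[fun_prop]
theorem PT.cons {f : α → β} {g : α → List β} (hf : PT f) (hg : PT g) :
    PT (fun a => f a :: g a) := by
  have : PT (fun x : β × List β => x.1 :: x.2) := .of_enc_eq fun _ => rfl
  exact this.comp (f := fun a => (f a, g a)) (by fun_prop)

/-- The remaining list lies above the pair of state and parameter, and its root symbol is the loop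
test. Pushing `true` glues both into one argument for `p`, and the pop separates the results. The
bound on the folds of all prefixes gives the same time bound for every round; without such a bound
the state could double in each round. -/
theorem foldl_loop_runs {step : γ → β → α → β} {p : Prog Alph} {P : Polynomial ℕ}
    (hp : ∀ (z : (α × List α) × (β × γ)) m, Runs p (mst ((enc z).ser ++ m))
      (mst ((enc (z.1.2, (step z.2.2 z.2.1 z.1.1, z.2.2))).ser ++ m)) (P.eval (size z)))
    (x : γ) (N B : ℕ) (m : List Bool) : ∀ (l : List α) (b : β), size l ≤ N →
    (∀ l', l' <+: l → size (l'.foldl (step x) b) ≤ B) →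
    Runs (.loop .main (· = some true) (.seq (.push .main true) (.seq p (.pop .main))))
      (mst ((enc l).ser ++ ((enc (b, x)).ser ++ m)))
      (mst (false :: ((enc (l.foldl (step x) b, x)).ser ++ m)))
      (l.length * (P.eval (N + B + size x + 2) + 3) + 1) := by
  intro l
  induction l with
  | nil =>
    intro b _ _
    exact (Runs.loop_done (by simp [enc_nil, D.ser])).mono (by simp)
  | cons a l ih =>
    intro b hN hB
    have h1 : Runs (.seq (.push .main true) (.seq p (.pop .main)))
        (mst ((enc (a :: l)).ser ++ ((enc (b, x)).ser ++ m)))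
        (mst ((enc l).ser ++ ((enc (step x b a, x)).ser ++ m)))
        (1 + (P.eval (size ((a, l), (b, x))) + 1)) := by
      refine Runs.seq (runs_push_main _ _) (Runs.seq ?_ (runs_pop_main true _))
      have := hp ((a, l), (b, x)) m
      rw [enc_mk (a, l), enc_mk l] at this
      rw [show enc (a :: l) = enc (a, l) from rfl]
      simpa [D.ser] using this
    have h2 := ih (step x b a) (by simp at hN; omega) fun l' hl' => by
      have := hB (a :: l') (by simpa using hl')
      simpa using this
    refine (Runs.loop_step (by simp [enc_cons, D.ser]) h1 h2).mono ?_
    have h3 : size ((a, l), (b, x)) ≤ N + B + size x + 2 := by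
      have := hB [] (by simp)
      simp at this hN ⊢
      omega
    have h4 := eval_mono P h3
    simp only [List.length_cons, add_mul]
    omega

/-- A fold over a list can be computed in polynomial time if the intermediate results have
polynomial size. -/
theorem PT.foldl {l : γ → List α} {init : γ → β} {step : γ → β → α → β} (hl : PT l)
    (hi : PT init) (hs : PT (fun z : γ × (β × α) => step z.1 z.2.1 z.2.2))
    (hb : ∃ B : Polynomial ℕ, ∀ x l', l' <+: l x →
      size (l'.foldl (step x) (init x)) ≤ B.eval (size x)) :
    PT (fun x => (l x).foldl (step x) (init x)) := by
  have h1 : PT (fun x => (l x, (init x, x))) := by fun_prop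
  have h2 : PT (fun z : (α × List α) × (β × γ) =>
      (z.1.2, (step z.2.2 z.2.1 z.1.1, z.2.2))) := by
    have := hs.comp (f := fun z : (α × List α) × (β × γ) => (z.2.2, (z.2.1, z.1.1))) (by fun_prop)
    fun_prop
  have h3 : PT (fun z : β × γ => z.1) := by fun_prop
  obtain ⟨L, hL⟩ := hl.size_le
  obtain ⟨B, hB⟩ := hb
  obtain ⟨p, P, hp⟩ := h1
  obtain ⟨q, Q, hq⟩ := h2
  obtain ⟨r, R, hr⟩ := h3
  refine ⟨.seq p (.seq (.pop .main) (.seq (.loop .main (· = Option.some true)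
    (.seq (.push .main true) (.seq q (.pop .main)))) (.seq (.pop .main) r))),
    P + L * (Q.comp (L + B + Polynomial.X + 2) + 3) + R.comp (B + Polynomial.X + 1) + 3,
    fun x m => ?_⟩
  have h4 : Runs (.pop .main) (mst ((enc (l x, (init x, x))).ser ++ m))
      (mst ((enc (l x)).ser ++ ((enc (init x, x)).ser ++ m))) 1 := by
    rw [enc_mk]
    simpa [D.ser] using runs_pop_main true ((enc (l x)).ser ++ ((enc (init x, x)).ser ++ m))
  refine (Runs.seq (hp x m) (Runs.seq h4 (Runs.seq (foldl_loop_runs hq x _ _ m (l x) (init x)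
    (hL x) (hB x)) (Runs.seq (runs_pop_main _ _) (hr _ m))))).mono ?_
  have h5 : size ((l x).foldl (step x) (init x), x) ≤ B.eval (size x) + size x + 1 := by
    have := hB x (l x) (List.prefix_refl _)
    simp
    omega
  have h6 := eval_mono R h5
  have h7 := Nat.mul_le_mul_right
    (Q.eval (L.eval (size x) + B.eval (size x) + size x + 2) + 3)
    ((length_le_size (l x)).trans (hL x))
  simp only [Polynomial.eval_add, Polynomial.eval_mul, Polynomial.eval_comp, Polynomial.eval_X,
    Polynomial.eval_one, Polynomial.eval_ofNat]
  omega

end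

end StackProgram

namespace StackProgram

/-! ### Lists and binary numbers -/

section
variable {α β γ δ : Type} [Enc α] [Enc β] [Enc γ] [Enc δ]

/-- A variant of `PT.foldl_add` with a measure `μ` which is linearly related to the size. -/
theorem PT.foldl_measure {l : γ → List α} {init : γ → β} {step : γ → β → α → β} (hl : PT l)
    (hi : PT init) (hs : PT (fun z : γ × (β × α) => step z.1 z.2.1 z.2.2)) (μ : β → ℕ) (c : ℕ)
    (hμ : ∀ b, μ b ≤ size b) (hμ' : ∀ b, size b ≤ c * μ b)
    (hb : ∃ B : Polynomial ℕ, ∀ x b a, μ (step x b a) ≤ μ b + B.eval (size x + size a)) :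
    PT (fun x => (l x).foldl (step x) (init x)) := by
  refine PT.foldl hl hi hs ?_
  obtain ⟨L, hL⟩ := hl.size_le
  obtain ⟨I, hI⟩ := hi.size_le
  obtain ⟨B, hB⟩ := hb
  refine ⟨c * (I + L * B.comp (Polynomial.X + L)), fun x l' hl' => ?_⟩
  -- The increments only depend on the parameter and the list entries, hence they have a common
  -- bound and add up linearly.
  have key : ∀ (k : List α) (b : β), (∀ a ∈ k, size a ≤ L.eval (size x)) →
      μ (k.foldl (step x) b) ≤
        μ b + k.length * B.eval (size x + L.eval (size x)) := by
    intro k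
    induction k with
    | nil => intro b _; simp
    | cons a k ih =>
      intro b hk
      have h1 := ih (step x b a) fun a' ha' => hk a' (List.mem_cons_of_mem _ ha')
      have h2 := hB x b a
      have h3 := eval_mono B (Nat.add_le_add_left (hk a List.mem_cons_self) (size x))
      simp only [List.foldl_cons, List.length_cons, add_mul]
      omega
  have h1 := key l' (init x) fun a ha => (size_mem (hl'.subset ha)).trans (hL x)
  have h2 : l'.length ≤ L.eval (size x) :=
    (length_le_size l').trans ((size_prefix hl').trans (hL x))
  have h3 := Nat.mul_le_mul_right (B.eval (size x + L.eval (size x))) h2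
  have h4 := (hμ (init x)).trans (hI x)
  refine (hμ' _).trans ?_
  simp
  exact Nat.mul_le_mul_left c (by omega)

/-- A fold over a list can be computed in polynomial time if every step adds at most a polynomial
to the size of the result. -/
theorem PT.foldl_add {l : γ → List α} {init : γ → β} {step : γ → β → α → β} (hl : PT l)
    (hi : PT init) (hs : PT (fun z : γ × (β × α) => step z.1 z.2.1 z.2.2))
    (hb : ∃ B : Polynomial ℕ, ∀ x b a, size (step x b a) ≤ size b + B.eval (size x + size a)) :
    PT (fun x => (l x).foldl (step x) (init x)) :=
  .foldl_measure hl hi hs size 1 (fun _ => le_rfl) (fun _ => by simp) hb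

@[fun_prop]
theorem PT.reverse {l : γ → List α} (hl : PT l) : PT (fun x => (l x).reverse) := by
  have : PT (fun x => (l x).foldl (fun b a => a :: b) []) :=
    .foldl_add (step := fun _ b a => a :: b) hl (by fun_prop) (by fun_prop)
      ⟨Polynomial.X + 1, fun x b a => by simp; omega⟩
  simpa [List.foldl_flip_cons_eq_append'] using this

theorem PT.foldr_add {l : γ → List α} {init : γ → β} {step : γ → α → β → β} (hl : PT l)
    (hi : PT init) (hs : PT (fun z : γ × (β × α) => step z.1 z.2.2 z.2.1))
    (hb : ∃ B : Polynomial ℕ, ∀ x b a, size (step x a b) ≤ size b + B.eval (size x + size a)) :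
    PT (fun x => (l x).foldr (step x) (init x)) := by
  have := PT.foldl_add (step := fun x b a => step x a b) hl.reverse hi hs hb
  simpa using this

@[fun_prop]
theorem PT.append {l l' : γ → List α} (hl : PT l) (hl' : PT l') :
    PT (fun x => l x ++ l' x) := by
  have : PT (fun x => (l x).foldr (fun a b => a :: b) (l' x)) :=
    .foldr_add (step := fun _ a b => a :: b) hl hl' (by fun_prop)
      ⟨Polynomial.X + 1, fun x b a => by simp; omega⟩
  simpa using this

theorem PT.map {l : γ → List α} {f : γ → α → β} (hl : PT l)
    (hf : PT (fun z : γ × α => f z.1 z.2)) : PT (fun x => (l x).map (f x)) := by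
  obtain ⟨F, hF⟩ := hf.size_le
  have : PT (fun x => (l x).foldr (fun a b => f x a :: b) []) := by
    refine .foldr_add (step := fun x a b => f x a :: b) hl (by fun_prop) ?_
      ⟨F.comp (Polynomial.X + 1) + 1, fun x b a => ?_⟩
    · have := hf.comp (f := fun z : γ × (List β × α) => (z.1, z.2.2)) (by fun_prop)
      fun_prop
    · have := hF (x, a)
      simp at this ⊢
      omega
  simpa [List.foldr_cons_eq_append] using this

theorem PT.flatMap {l : γ → List α} {f : γ → α → List β} (hl : PT l)
    (hf : PT (fun z : γ × α => f z.1 z.2)) : PT (fun x => (l x).flatMap (f x)) := by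
  obtain ⟨F, hF⟩ := hf.size_le
  have : PT (fun x => (l x).foldr (fun a b => f x a ++ b) []) := by
    refine .foldr_add (step := fun x a b => f x a ++ b) hl (by fun_prop) ?_
      ⟨F.comp (Polynomial.X + 1), fun x b a => ?_⟩
    · have := hf.comp (f := fun z : γ × (List β × α) => (z.1, z.2.2)) (by fun_prop)
      fun_prop
    · have h1 := hF (x, a)
      have h2 := size_append (f x a) b
      simp at h1 ⊢
      omega
  convert this using 2 with x
  induction l x with
  | nil => rfl
  | cons a t ih => simp [ih]

@[fun_prop]
theorem PT.tail {l : γ → List α} (hl : PT l) : PT (fun x => (l x).tail) := by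
  refine .list_cases (f := fun _ => []) (g := fun z => z.2.2) hl (by fun_prop) (by fun_prop) ?_ ?_
  · intro a h; simp [h]
  · intro a b t h; simp [h]

@[fun_prop]
theorem PT.head? {l : γ → List α} (hl : PT l) : PT (fun x => (l x).head?) := by
  refine .list_cases (f := fun _ => none) (g := fun z => Option.some z.2.1) hl (by fun_prop)
    (by fun_prop) ?_ ?_
  · intro a h; simp [h]
  · intro a b t h; simp [h]

@[fun_prop]
theorem PT.getD {o : γ → Option α} {d : γ → α} (ho : PT o) (hd : PT d) :
    PT (fun x => (o x).getD (d x)) := by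
  have := PT.option_elim (g := fun z : γ × α => z.2) ho hd (by fun_prop)
  convert this using 2 with x
  cases o x <;> rfl

theorem PT.of_bool {b : α → Bool} {f : α → Bool → β} (hb : PT b) (h1 : PT fun a => f a true)
    (h2 : PT fun a => f a false) : PT (fun a => f a (b a)) := by
  convert PT.cond hb h1 h2 using 2 with a
  cases b a <;> rfl

@[fun_prop]
theorem PT.and {b c : α → Bool} (hb : PT b) (hc : PT c) : PT (fun a => b a && c a) :=
  .of_bool (f := fun a y => y && c a) hb (by simpa using hc) (by simpa using PT.const _)

@[fun_prop]
theorem PT.or {b c : α → Bool} (hb : PT b) (hc : PT c) : PT (fun a => b a || c a) :=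
  .of_bool (f := fun a y => y || c a) hb (by simpa using PT.const _) (by simpa using hc)

@[fun_prop]
theorem PT.not {b : α → Bool} (hb : PT b) : PT (fun a => !b a) :=
  .of_bool (f := fun a y => !y) hb (by fun_prop) (by fun_prop)

@[fun_prop]
theorem PT.xor {b c : α → Bool} (hb : PT b) (hc : PT c) : PT (fun a => b a ^^ c a) :=
  .of_bool (f := fun a y => y ^^ c a) hb (by simpa using hc.not) (by simpa using hc)

/-- Pair the elements of two lists, continuing to the end of the longer one. -/
def zipLong {α β : Type} : List α → List β → List (Option α × Option β)
  | [], l' => l'.map fun b => (none, some b)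
  | a :: l, l' => (some a, l'.head?) :: zipLong l l'.tail

/-- One step of the computation of `zipLong`. -/
def zipStep {α β : Type} (s : List β × List (Option α × Option β)) (a : α) :
    List β × List (Option α × Option β) :=
  (s.1.tail, (some a, s.1.head?) :: s.2)

/-- Invariant of the fold: the state holds the unread part of the second list and the pairs so far,
in reverse order. -/
theorem zipLong_eq {α β : Type} (l : List α) : ∀ (l' : List β) (r : List (Option α × Option β)),
    r.reverse ++ zipLong l l' = (l.foldl zipStep (l', r)).2.reverse ++
      (l.foldl zipStep (l', r)).1.map fun b => (none, some b) := by
  induction l with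
  | nil => intro l' r; rfl
  | cons a l ih =>
    intro l' r
    rw [List.foldl_cons, zipStep, ← ih]
    simp [zipLong]

@[fun_prop]
theorem PT.zipLong {l : γ → List α} {l' : γ → List β} (hl : PT l) (hl' : PT l') :
    PT (fun x => zipLong (l x) (l' x)) := by
  have h : PT (fun x => (l x).foldl zipStep (l' x, ([] : List (Option α × Option β)))) := by
    refine .foldl_add (step := fun _ s a => zipStep s a)
      hl (by fun_prop) (by unfold zipStep; fun_prop) ⟨Polynomial.X + 6, fun x b a => ?_⟩
    obtain ⟨b, c⟩ := b
    cases b <;> simp [zipStep] <;> omega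
  have h2 : PT (fun x => ((l x).foldl zipStep (l' x, ([] : List (Option α × Option β)))).1.map
      fun b => ((none : Option α), Option.some b)) :=
    .map (f := fun _ b => ((none : Option α), Option.some b)) (by fun_prop) (by fun_prop)
  have h3 := h.snd.reverse.append h2
  convert h3 using 2 with x
  simpa using zipLong_eq (l x) (l' x) []

end

end StackProgram

namespace StackProgram

/-! ### Binary arithmetic -/

/-- The number with the given binary digits, the least significant digit first. -/
def val : List Bool → ℕ
  | [] => 0
  | b :: l => b.toNat + 2 * val l

theorem val_append (l l' : List Bool) : val (l ++ l') = val l + 2 ^ l.length * val l' := by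
  induction l with
  | nil => simp [val]
  | cons b l ih => simp [val, ih, pow_succ]; ring

/-- Padding at the most significant end by zeros preserves the value. -/
theorem val_map_fst (l : List Bool) : ∀ l' : List Bool,
    val ((zipLong l l').map fun p => p.1.getD false) = val l := by
  induction l with
  | nil =>
    intro l'
    induction l' with
    | nil => rfl
    | cons b l' ih => simpa [zipLong, val] using ih
  | cons a l ih => intro l'; simp [zipLong, val, ih]

theorem val_map_snd (l : List Bool) : ∀ l' : List Bool,
    val ((zipLong l l').map fun p => p.2.getD false) = val l' := by
  induction l with
  | nil => intro l'; simp [zipLong, Function.comp_def]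
  | cons a l ih =>
    intro l'
    cases l' with
    | nil => simp [zipLong, val, ih]
    | cons b l' => simp [zipLong, val, ih]

theorem length_zipLong {α β : Type} (l : List α) : ∀ l' : List β,
    (zipLong l l').length = max l.length l'.length := by
  induction l with
  | nil => intro l'; simp [zipLong]
  | cons a l ih => intro l'; simp [zipLong, ih]; omega

/-- One step of the binary addition; the state consists of the carry and of the digits so far. -/
def addStep (s : Bool × List Bool) (p : Option Bool × Option Bool) : Bool × List Bool :=
  ((p.1.getD false && p.2.getD false) || (s.1 && (p.1.getD false ^^ p.2.getD false)),
    (p.1.getD false ^^ (p.2.getD false ^^ s.1)) :: s.2)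

/-- Binary addition. -/
def binAdd (l l' : List Bool) : List Bool :=
  (((zipLong l l').foldl addStep (false, [])).1 ::
    ((zipLong l l').foldl addStep (false, [])).2).reverse

/-- Invariant of the addition: the carry and the unread digits count with the weight $2^k$, where
$k$ is the number of digits already produced. -/
theorem val_addStep (l : List (Option Bool × Option Bool)) : ∀ s : Bool × List Bool,
    val ((l.foldl addStep s).1 :: (l.foldl addStep s).2).reverse =
      val s.2.reverse + 2 ^ s.2.length * (s.1.toNat + val (l.map fun p => p.1.getD false) +
        val (l.map fun p => p.2.getD false)) := by
  induction l with
  | nil => intro s; simp [val_append, val]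
  | cons p l ih =>
    intro s
    rw [List.foldl_cons, ih]
    obtain ⟨c, out⟩ := s
    obtain ⟨a, b⟩ := p
    simp only [addStep, List.reverse_cons, val_append, List.length_cons, List.map_cons, val]
    generalize a.getD false = a
    generalize b.getD false = b
    cases a <;> cases b <;> cases c <;> simp <;> ring

theorem val_binAdd (l l' : List Bool) : val (binAdd l l') = val l + val l' := by
  rw [binAdd, val_addStep]
  simp [val, val_map_fst, val_map_snd]

theorem length_addStep (l : List (Option Bool × Option Bool)) : ∀ s : Bool × List Bool,
    (l.foldl addStep s).2.length = s.2.length + l.length := by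
  induction l with
  | nil => intro s; rfl
  | cons p l ih => intro s; rw [List.foldl_cons, ih]; simp [addStep]; omega

theorem length_binAdd (l l' : List Bool) :
    (binAdd l l').length = max l.length l'.length + 1 := by
  simp [binAdd, length_addStep, length_zipLong]

/-- One step of the comparison of binary numbers. -/
def leStep (r : Bool) (p : Option Bool × Option Bool) : Bool :=
  bif p.1.getD false ^^ p.2.getD false then p.2.getD false else r

/-- The comparison of binary numbers. -/
def binLe (l l' : List Bool) : Bool := (zipLong l l').foldl leStep true

/-- Digits are read from the least significant one on, so each later difference overrides the
verdict so far. -/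
theorem foldl_leStep (l : List (Option Bool × Option Bool)) : ∀ r : Bool,
    l.foldl leStep r = true ↔
      val (l.map fun p => p.1.getD false) < val (l.map fun p => p.2.getD false) ∨
      val (l.map fun p => p.1.getD false) = val (l.map fun p => p.2.getD false) ∧ r = true := by
  induction l with
  | nil => intro r; simp
  | cons p l ih =>
    intro r
    rw [List.foldl_cons, ih]
    obtain ⟨a, b⟩ := p
    simp only [leStep, List.map_cons, val]
    generalize a.getD false = a
    generalize b.getD false = b
    cases a <;> cases b <;> simp <;> omega

theorem binLe_iff (l l' : List Bool) : binLe l l' = true ↔ val l ≤ val l' := by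
  rw [binLe, foldl_leStep, val_map_fst, val_map_snd]
  simp
  omega

/-- The minimum of two binary numbers. -/
def binMin (l l' : List Bool) : List Bool := bif binLe l l' then l else l'

theorem binMin_cases (l l' : List Bool) : binMin l l' = l ∨ binMin l l' = l' := by
  rw [binMin]
  cases binLe l l' <;> simp

theorem val_binMin (l l' : List Bool) : val (binMin l l') = min (val l) (val l') := by
  have := binLe_iff l l'
  rw [binMin]
  cases h : binLe l l' <;> simp [h] at this ⊢ <;> omega

/-- The product of a binary and a unary number. -/
def mulUnary (l : List Bool) (u : List Unit) : List Bool := u.foldl (fun r _ => binAdd l r) []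

theorem val_mulUnary (l : List Bool) (u : List Unit) : val (mulUnary l u) = val l * u.length := by
  suffices h : ∀ r, val (u.foldl (fun r _ => binAdd l r) r) = val r + val l * u.length by
    simpa [val, mulUnary] using h []
  induction u with
  | nil => simp
  | cons _ u ih => intro r; rw [List.foldl_cons, ih, val_binAdd]; simp; ring

theorem size_le_length (l : List Bool) : size l ≤ 4 * l.length + 1 := by
  induction l with
  | nil => simp
  | cons b l ih => have := size_bool_le b; simp; omega

theorem length_lt_size (l : List Bool) : l.length + 1 ≤ size l := by
  induction l with
  | nil => simp
  | cons b l ih => simp; omega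

theorem size_list_unit (l : List Unit) : size l = 2 * l.length + 1 := by
  induction l with
  | nil => simp
  | cons b l ih => simp; omega

section
variable {α : Type} [Enc α]

@[fun_prop]
theorem PT.binAdd {f g : α → List Bool} (hf : PT f) (hg : PT g) :
    PT (fun a => binAdd (f a) (g a)) := by
  have h : PT (fun a => (StackProgram.zipLong (f a) (g a)).foldl addStep (false, [])) := by
    refine .foldl_add (step := fun _ s p => addStep s p) (by fun_prop) (by fun_prop)
      (by unfold addStep; fun_prop) ⟨6, fun x s p => ?_⟩
    obtain ⟨c, out⟩ := s
    have h1 := size_bool_le ((p.1.getD false && p.2.getD false) ||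
      (c && (p.1.getD false ^^ p.2.getD false)))
    have h2 := size_bool_le (p.1.getD false ^^ (p.2.getD false ^^ c))
    have h3 : 1 ≤ size c := by cases c <;> simp
    simp [addStep]
    omega
  unfold StackProgram.binAdd
  fun_prop

@[fun_prop]
theorem PT.binLe {f g : α → List Bool} (hf : PT f) (hg : PT g) :
    PT (fun a => binLe (f a) (g a)) := by
  refine .foldl_add (step := fun _ s p => leStep s p) (by fun_prop) (by fun_prop)
    (by unfold leStep; fun_prop) ⟨3, fun x s p => ?_⟩
  have := size_bool_le (leStep s p)
  simp
  omega

@[fun_prop]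
theorem PT.binMin {f g : α → List Bool} (hf : PT f) (hg : PT g) :
    PT (fun a => binMin (f a) (g a)) := by
  unfold StackProgram.binMin
  fun_prop

@[fun_prop]
theorem PT.mulUnary {f : α → List Bool} {g : α → List Unit} (hf : PT f) (hg : PT g) :
    PT (fun a => mulUnary (f a) (g a)) := by
  obtain ⟨F, hF⟩ := hf.size_le
  -- An addition can rewrite all digits, and the two digits have different sizes. The number of
  -- digits is a measure that grows additively; the factor `4` converts it back to the size.
  refine .foldl_measure (step := fun x r _ => StackProgram.binAdd (f x) r) hg (by fun_prop)
    (by fun_prop) (fun l => l.length + 1) 4 length_lt_size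
    (fun b => by have := size_le_length b; omega) ⟨F + 1, fun x r u => ?_⟩
  have h1 := length_lt_size (f x)
  have h2 := hF x
  have h3 := eval_mono F (Nat.le_add_right (size x) (size u))
  simp only [length_binAdd, Polynomial.eval_add, Polynomial.eval_one]
  omega

end

/-! ### Looking up an entry of a list at a binary index -/

section
variable {α β : Type} [Enc α] [Enc β]

/-- The entries at even and at odd positions. -/
def split {α : Type} (l : List α) : List α × List α := l.foldr (fun a s => (a :: s.2, s.1)) ([], [])

theorem split_getElem? {α : Type} (l : List α) : ∀ i : ℕ,
    (split l).1[i]? = l[2 * i]? ∧ (split l).2[i]? = l[2 * i + 1]? := by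
  induction l with
  | nil => intro i; simp [split]
  | cons a l ih =>
    intro i
    have e : split (a :: l) = (a :: (split l).2, (split l).1) := rfl
    rw [e]
    refine ⟨?_, by simpa using (ih i).1⟩
    cases i with
    | zero => simp
    | succ i => simpa [mul_add] using (ih i).2

theorem size_split (l : List α) : size (split l).1 + size (split l).2 = size l + 1 := by
  induction l with
  | nil => simp [split]
  | cons a l ih =>
    have e : split (a :: l) = (a :: (split l).2, (split l).1) := rfl
    rw [e]
    simp
    omega

@[fun_prop]
theorem PT.split {f : α → List β} (hf : PT f) : PT (fun a => split (f a)) := by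
  refine .foldr_add (step := fun _ a s => (a :: s.2, s.1)) hf (by fun_prop) (by fun_prop)
    ⟨Polynomial.X + 1, fun x s a => ?_⟩
  obtain ⟨s, t⟩ := s
  simp
  omega

/-- The Boolean entry of a list at a position which is given in binary. -/
def lookup (l : List Bool) (i : List Bool) : Bool :=
  (i.foldl (fun l b => bif b then (split l).2 else (split l).1) l).head?.getD false

/-- The lowest bit of the index selects the even or the odd positions, and the remaining bits are
the index within that half. -/
theorem lookup_eq (i : List Bool) : ∀ l : List Bool, lookup l i = l[val i]?.getD false := by
  induction i with
  | nil => intro l; simp [lookup, val, List.head?_eq_getElem?]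
  | cons b i ih =>
    intro l
    have e : lookup l (b :: i) = lookup (bif b then (split l).2 else (split l).1) i := rfl
    rw [e, ih]
    cases b
    · simp [val, (split_getElem? l _).1]
    · simp [val, (split_getElem? l _).2, add_comm]

@[fun_prop]
theorem PT.lookup {f g : α → List Bool} (hf : PT f) (hg : PT g) :
    PT (fun a => lookup (f a) (g a)) := by
  refine .getD (.head? (.foldl_add (step := fun _ l b => bif b then (StackProgram.split l).2 else
    (StackProgram.split l).1) hg hf (by fun_prop) ⟨0, fun x l b => ?_⟩)) (by fun_prop)
  have h1 := size_split l
  have h2 : 1 ≤ size (StackProgram.split l).1 := by cases (StackProgram.split l).1 <;> simp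
  have h3 : 1 ≤ size (StackProgram.split l).2 := by cases (StackProgram.split l).2 <;> simp
  cases b <;> simp <;> omega

/-! ### Counting pairs -/

/-- One step of `pairCount`; the state consists of two unary numbers. -/
def pairStep (p : Bool → Bool) (s : List Unit × List Unit) (b : Bool) : List Unit × List Unit :=
  (bif p b then () :: s.1 else s.1, bif b then s.1 ++ s.2 else s.2)

/-- The number, in unary, of the pairs of an entry `a` with `p a` and a later entry which is
`true`. -/
def pairCount (p : Bool → Bool) (l : List Bool) : List Unit := (l.foldl (pairStep p) ([], [])).2

/-- A step adds one part of the state to the other, so `PT.foldl_add` does not apply directly. But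
the first part grows by at most one per step, which makes the second part quadratic. -/
theorem length_foldl_pairStep (p : Bool → Bool) (l : List Bool) : ∀ s : List Unit × List Unit,
    (l.foldl (pairStep p) s).1.length ≤ s.1.length + l.length ∧
    (l.foldl (pairStep p) s).2.length ≤ s.2.length + l.length * (s.1.length + l.length) := by
  induction l with
  | nil => intro s; simp
  | cons b l ih =>
    intro s
    obtain ⟨h1, h2⟩ := ih (pairStep p s b)
    have h3 : (pairStep p s b).1.length ≤ s.1.length + 1 := by
      simp only [pairStep]; cases p b <;> simp
    have h4 : (pairStep p s b).2.length ≤ s.2.length + s.1.length := by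
      simp only [pairStep]; cases b <;> simp; omega
    refine ⟨by simp only [List.foldl_cons, List.length_cons]; omega, ?_⟩
    have h5 := Nat.mul_le_mul_left l.length (Nat.add_le_add_right h3 l.length)
    simp only [List.foldl_cons, List.length_cons]
    have e : (l.length + 1) * (s.1.length + (l.length + 1)) =
      l.length * (s.1.length + 1 + l.length) + (s.1.length + (l.length + 1)) := by ring
    omega

@[fun_prop]
theorem PT.pairCount (p : Bool → Bool) {f : α → List Bool} (hf : PT f) :
    PT (fun a => pairCount p (f a)) := by
  obtain ⟨F, hF⟩ := hf.size_le
  refine .snd (.foldl (step := fun _ s b => pairStep p s b) hf (by fun_prop) ?_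
    ⟨2 * F + 2 * F * F + 3, fun x l' hl' => ?_⟩)
  · have h1 : PT (fun z : α × ((List Unit × List Unit) × Bool) => p z.2.2) :=
      .of_bool (f := fun _ y => p y) (by fun_prop) (by fun_prop) (by fun_prop)
    exact .mk (.cond h1 (by fun_prop) (by fun_prop)) (by fun_prop)
  · have h1 := length_foldl_pairStep p l' ([], [])
    have h2 : l'.length ≤ F.eval (size x) :=
      (length_le_size l').trans ((size_prefix hl').trans (hF x))
    have h3 := Nat.mul_le_mul h2 h2
    generalize l'.foldl (pairStep p) ([], []) = s at h1
    obtain ⟨s, t⟩ := s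
    simp only [size_mk, size_list_unit, Polynomial.eval_add, Polynomial.eval_mul,
      Polynomial.eval_ofNat, List.length_nil, zero_add, mul_assoc] at h1 ⊢
    omega

theorem pairCount_length (p : Bool → Bool) : ∀ {m : ℕ} (u : Fin m → Bool),
    (pairCount p (List.ofFn u)).length =
      ∑ r', ∑ r, if r < r' ∧ p (u r) = true ∧ u r' = true then 1 else 0 := by
  have key : ∀ {m : ℕ} (u : Fin m → Bool),
      ((List.ofFn u).foldl (pairStep p) ([], [])).1.length =
        ∑ r, (if p (u r) = true then 1 else 0) ∧
      ((List.ofFn u).foldl (pairStep p) ([], [])).2.length =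
        ∑ r', ∑ r, if r < r' ∧ p (u r) = true ∧ u r' = true then 1 else 0 := by
    intro m
    induction m with
    | zero => intro u; simp
    | succ m ih =>
      intro u
      obtain ⟨h1, h2⟩ := ih fun r => u r.castSucc
      rw [List.ofFn_succ', List.concat_eq_append, List.foldl_append]
      simp only [List.foldl_cons, List.foldl_nil, pairStep, Fin.sum_univ_castSucc]
      constructor
      · cases h : p (u (Fin.last m)) <;> simp [h1]
      · cases h : u (Fin.last m) <;> simp [h2, h1, Fin.castSucc_lt_last, not_lt.2 (Fin.le_last _), add_comm]
  exact fun {m} u => (key u).2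

end

end StackProgram

namespace StackProgram

/-! ### The dynamic program -/

/-- The pointwise minimum of two lists of binary numbers. -/
def pmin (X Y : List (List Bool)) : List (List Bool) :=
  -- A missing entry stands for infinite cost: it is replaced by the entry of the other list, which
  -- then is the minimum.
  (zipLong X Y).map fun p => binMin (p.1.getD (p.2.getD [])) (p.2.getD (p.1.getD []))

/-- The list `L` of costs has at the position `G` an entry which is at most `c`. -/
def Attains (L : List (List Bool)) (G c : ℕ) : Prop := ∃ b, L[G]? = some b ∧ val b ≤ c

theorem attains_nil (G c : ℕ) : ¬ Attains [] G c := by simp [Attains]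

theorem attains_cons_zero (a : List Bool) (L : List (List Bool)) (c : ℕ) :
    Attains (a :: L) 0 c ↔ val a ≤ c := by simp [Attains]

theorem attains_cons_succ (a : List Bool) (L : List (List Bool)) (G c : ℕ) :
    Attains (a :: L) (G + 1) c ↔ Attains L G c := by simp [Attains]

theorem attains_map_binAdd (a : List Bool) (L : List (List Bool)) (G c : ℕ) :
    Attains (L.map (binAdd a)) G c ↔ ∃ c', val a + c' ≤ c ∧ Attains L G c' := by
  simp only [Attains, List.getElem?_map, Option.map_eq_some_iff]
  constructor
  · rintro ⟨_, ⟨b, h, rfl⟩, h2⟩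
    exact ⟨val b, by rwa [val_binAdd] at h2, b, h, le_rfl⟩
  · rintro ⟨c', h, b, h1, h2⟩
    exact ⟨_, ⟨b, h1, rfl⟩, by rw [val_binAdd]; omega⟩

theorem pmin_nil_left (Y : List (List Bool)) : pmin [] Y = Y := by
  simp only [pmin, zipLong, List.map_map]
  conv_rhs => rw [← List.map_id Y]
  refine List.map_congr_left fun b _ => ?_
  simpa using binMin_cases b b

theorem pmin_nil_right (X : List (List Bool)) : pmin X [] = X := by
  induction X with
  | nil => rfl
  | cons a X ih =>
    have e : pmin (a :: X) [] = binMin a a :: pmin X [] := by simp [pmin, zipLong]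
    have := binMin_cases a a
    rw [e, ih]
    simpa using this

theorem pmin_cons (a b : List Bool) (X Y : List (List Bool)) :
    pmin (a :: X) (b :: Y) = binMin a b :: pmin X Y := by
  simp [pmin, zipLong]

theorem attains_pmin (X : List (List Bool)) : ∀ (Y : List (List Bool)) (G c : ℕ),
    Attains (pmin X Y) G c ↔ Attains X G c ∨ Attains Y G c := by
  induction X with
  | nil => intro Y G c; simp [pmin_nil_left, attains_nil]
  | cons a X ih =>
    intro Y G c
    cases Y with
    | nil => simp [pmin_nil_right, attains_nil]
    | cons b Y =>
      cases G with
      | zero => simp [pmin_cons, attains_cons_zero, val_binMin]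
      | succ G => simp [pmin_cons, attains_cons_succ, ih]

theorem size_pmin (X : List (List Bool)) : ∀ Y : List (List Bool),
    size (pmin X Y) ≤ size X + size Y := by
  induction X with
  | nil => intro Y; simp [pmin_nil_left]
  | cons a X ih =>
    intro Y
    cases Y with
    | nil => simp [pmin_nil_right]
    | cons b Y =>
      have := ih Y
      rw [pmin_cons]
      rcases binMin_cases a b with h | h <;> simp [h] <;> omega

theorem length_pmin (X Y : List (List Bool)) :
    (pmin X Y).length = max X.length Y.length := by
  simp [pmin, length_zipLong]

theorem mem_pmin (X : List (List Bool)) : ∀ (Y : List (List Bool)) (b : List Bool),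
    b ∈ pmin X Y → b ∈ X ∨ b ∈ Y := by
  induction X with
  | nil => intro Y b; simp [pmin_nil_left]
  | cons a X ih =>
    intro Y b hb
    cases Y with
    | nil => exact Or.inl (by simpa [pmin_nil_right] using hb)
    | cons a' Y =>
      rw [pmin_cons, List.mem_cons] at hb
      rcases hb with rfl | hb
      · rcases binMin_cases a a' with h | h <;> simp [h]
      · rcases ih Y b hb with h | h <;> simp [h]

/-- The min-plus convolution of a table of costs with a nonempty table, given by its head and its
tail. -/
def conv (t : List Bool × List (List Bool)) (F : List (List Bool)) : List (List Bool) :=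
  F.foldr (fun a r => binAdd a t.1 :: pmin (t.2.map (binAdd a)) r) []

theorem conv_cons (t : List Bool × List (List Bool)) (a : List Bool) (F : List (List Bool)) :
    conv t (a :: F) = binAdd a t.1 :: pmin (t.2.map (binAdd a)) (conv t F) := rfl

/-- The entry of `F` at position $G_1$ contributes the table `t`, raised by this entry and shifted
by $G_1$. The shift comes from the nesting of the `cons` in the recursion, and `pmin` merges the
contributions. -/
theorem attains_conv (t : List Bool × List (List Bool)) (F : List (List Bool)) : ∀ (G c : ℕ),
    Attains (conv t F) G c ↔ ∃ G₁ G₂ c₁ c₂, G₁ + G₂ = G ∧ c₁ + c₂ ≤ c ∧ Attains F G₁ c₁ ∧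
      Attains (t.1 :: t.2) G₂ c₂ := by
  induction F with
  | nil =>
    intro G c
    have e : conv t [] = [] := rfl
    simp [e, attains_nil]
  | cons a F ih =>
    intro G c
    rw [conv_cons]
    cases G with
    | zero =>
      rw [attains_cons_zero, val_binAdd]
      constructor
      · intro h
        exact ⟨0, 0, val a, val t.1, rfl, h, by simp [attains_cons_zero],
          by simp [attains_cons_zero]⟩
      · rintro ⟨G₁, G₂, c₁, c₂, hG, hc, h1, h2⟩
        obtain ⟨rfl, rfl⟩ : G₁ = 0 ∧ G₂ = 0 := by omega
        rw [attains_cons_zero] at h1 h2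
        omega
    | succ G =>
      rw [attains_cons_succ, attains_pmin, attains_map_binAdd, ih]
      constructor
      · rintro (⟨c', h1, h2⟩ | ⟨G₁, G₂, c₁, c₂, hG, hc, h1, h2⟩)
        · exact ⟨0, G + 1, val a, c', by omega, h1, by simp [attains_cons_zero],
            by simpa [attains_cons_succ] using h2⟩
        · exact ⟨G₁ + 1, G₂, c₁, c₂, by omega, hc, by simpa [attains_cons_succ] using h1, h2⟩
      · rintro ⟨G₁, G₂, c₁, c₂, hG, hc, h1, h2⟩
        cases G₁ with
        | zero =>
          obtain rfl : G₂ = G + 1 := by omega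
          rw [attains_cons_zero] at h1
          rw [attains_cons_succ] at h2
          exact Or.inl ⟨c₂, by omega, h2⟩
        | succ G₁ =>
          rw [attains_cons_succ] at h1
          exact Or.inr ⟨G₁, G₂, c₁, c₂, by omega, hc, h1, h2⟩

theorem length_conv (t : List Bool × List (List Bool)) (F : List (List Bool)) :
    (conv t F).length ≤ F.length + t.2.length := by
  induction F with
  | nil => simp [conv]
  | cons a F ih =>
    rw [conv_cons, List.length_cons, length_pmin, List.length_map, List.length_cons]
    omega

/-- Every entry is a single sum of two entries, so a convolution costs one more digit, while by
`length_conv` the table lengths at most add up. Hence all intermediate tables are polynomial. -/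
theorem width_conv (t : List Bool × List (List Bool)) (w : ℕ) (ht : t.1.length ≤ w)
    (ht' : ∀ b ∈ t.2, b.length ≤ w) (F : List (List Bool)) (hF : ∀ b ∈ F, b.length ≤ w) :
    ∀ b ∈ conv t F, b.length ≤ w + 1 := by
  induction F with
  | nil => simp [conv]
  | cons a F ih =>
    have ha := hF a List.mem_cons_self
    intro b hb
    rw [conv_cons, List.mem_cons] at hb
    rcases hb with rfl | hb
    · rw [length_binAdd]; omega
    · rcases mem_pmin _ _ _ hb with h | h
      · obtain ⟨b', hb', rfl⟩ := List.mem_map.1 h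
        have := ht' b' hb'
        rw [length_binAdd]; omega
      · exact ih (fun b' hb' => hF b' (List.mem_cons_of_mem _ hb')) b h

theorem size_le_width (F : List (List Bool)) (w : ℕ) (hF : ∀ b ∈ F, b.length ≤ w) :
    size F ≤ F.length * (4 * w + 2) + 1 := by
  induction F with
  | nil => simp
  | cons a F ih =>
    have h1 := ih fun b hb => hF b (List.mem_cons_of_mem _ hb)
    have h2 := hF a List.mem_cons_self
    have h3 := size_le_length a
    simp only [size_cons, List.length_cons, add_mul]
    omega

/-- The table of the minimal costs for a list of voters whose tables are given by `T`. -/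
def costTable {α : Type} (T : α → List Bool × List (List Bool)) (l : List α) : List (List Bool) :=
  l.foldl (fun F a => conv (T a) F) [[]]

/-- The initial table `[[]]` belongs to no voters: gain $0$ at cost $0$, the empty digit list having
the value $0$. Splitting off the last voter is one convolution. -/
theorem attains_costTable {α : Type} (T : α → List Bool × List (List Bool)) : ∀ {n : ℕ}
    (w : Fin n → α) (G c : ℕ), Attains (costTable T (List.ofFn w)) G c ↔
      ∃ g k : Fin n → ℕ, ∑ i, g i = G ∧ ∑ i, k i ≤ c ∧
        ∀ i, Attains ((T (w i)).1 :: (T (w i)).2) (g i) (k i) := by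
  intro n
  induction n with
  | zero =>
    intro w G c
    cases G <;> simp [costTable, attains_cons_zero, attains_cons_succ, attains_nil, val]
  | succ n ih =>
    intro w G c
    have e : costTable T (List.ofFn w) =
        conv (T (w (Fin.last n))) (costTable T (List.ofFn fun i => w i.castSucc)) := by
      rw [List.ofFn_succ', List.concat_eq_append, costTable, List.foldl_append]
      rfl
    rw [e, attains_conv]
    constructor
    · rintro ⟨G₁, G₂, c₁, c₂, hG, hc, h1, h2⟩
      obtain ⟨g, k, hg, hk, h⟩ := (ih _ _ _).1 h1
      refine ⟨Fin.snoc (α := fun _ => ℕ) g G₂, Fin.snoc (α := fun _ => ℕ) k c₂, ?_, ?_, ?_⟩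
      · simp [Fin.sum_univ_castSucc, hg, hG]
      · simp [Fin.sum_univ_castSucc]; omega
      · intro i
        refine Fin.lastCases ?_ (fun i => ?_) i
        · simpa using h2
        · simpa using h i
    · rintro ⟨g, k, hg, hk, h⟩
      rw [Fin.sum_univ_castSucc] at hg hk
      exact ⟨_, _, _, _, hg, hk, (ih _ _ _).2 ⟨_, _, rfl, le_rfl, fun i => h i.castSucc⟩,
        h (Fin.last n)⟩

section
variable {α β γ : Type} [Enc α] [Enc β] [Enc γ]

@[fun_prop]
theorem PT.pmin {f g : α → List (List Bool)} (hf : PT f) (hg : PT g) :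
    PT (fun a => pmin (f a) (g a)) :=
  .map (f := fun _ (p : Option (List Bool) × Option (List Bool)) =>
    StackProgram.binMin (p.1.getD (p.2.getD [])) (p.2.getD (p.1.getD []))) (by fun_prop)
    (by fun_prop)

@[fun_prop]
theorem PT.conv {f : α → List Bool × List (List Bool)} {g : α → List (List Bool)} (hf : PT f)
    (hg : PT g) : PT (fun a => conv (f a) (g a)) := by
  have h1 : PT (fun z : α × List Bool => StackProgram.binAdd z.2 (f z.1).1) := by fun_prop
  have h2 : PT (fun z : α × List Bool => (f z.1).2.map (StackProgram.binAdd z.2)) :=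
    .map (f := fun (z : α × List Bool) b => StackProgram.binAdd z.2 b) (by fun_prop) (by fun_prop)
  obtain ⟨P, hP⟩ := h1.size_le
  obtain ⟨Q, hQ⟩ := h2.size_le
  refine .foldr_add (step := fun x a r => StackProgram.binAdd a (f x).1 ::
    StackProgram.pmin ((f x).2.map (StackProgram.binAdd a)) r) hg (by fun_prop) ?_
    ⟨P.comp (Polynomial.X + 1) + Q.comp (Polynomial.X + 1) + 1, fun x r a => ?_⟩
  · have := h2.comp (f := fun z : α × (List (List Bool) × List Bool) => (z.1, z.2.2)) (by fun_prop)
    fun_prop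
  · have h3 := hP (x, a)
    have h4 := hQ (x, a)
    have h5 := size_pmin ((f x).2.map (StackProgram.binAdd a)) r
    simp at h3 h4 ⊢
    omega

theorem PT.costTable {l : γ → List α} {T : γ → α → List Bool × List (List Bool)} (hl : PT l)
    (hT : PT (fun z : γ × α => T z.1 z.2)) : PT (fun x => costTable (T x) (l x)) := by
  obtain ⟨L, hL⟩ := hl.size_le
  obtain ⟨P, hP⟩ := hT.size_le
  have hs : PT (fun z : γ × (List (List Bool) × α) => T z.1 z.2.2) :=
    hT.comp (f := fun z : γ × (List (List Bool) × α) => (z.1, z.2.2)) (by fun_prop)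
  refine .foldl (step := fun x F a => StackProgram.conv (T x a) F) hl (by fun_prop) (by fun_prop)
    ⟨(1 + L * P.comp (Polynomial.X + L + 1)) * (4 * (P.comp (Polynomial.X + L + 1) + L) + 2) + 1,
      fun x l' hl' => ?_⟩
  have h1 : ∀ a ∈ l', size (T x a) ≤ P.eval (size x + L.eval (size x) + 1) := fun a ha => by
    have := (size_mem (hl'.subset ha)).trans (hL x)
    exact (hP (x, a)).trans (eval_mono P (by simp; omega))
  generalize hN : P.eval (size x + L.eval (size x) + 1) = N at h1
  -- With `N` bounding the table of each voter, the number of entries and the number of digits are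
  -- tracked separately; the size is bounded by their product only at the end.
  have h2 : ∀ (k : List α) (F : List (List Bool)) (w : ℕ), (∀ a ∈ k, size (T x a) ≤ N) → N ≤ w →
      (∀ b ∈ F, b.length ≤ w) →
      (k.foldl (fun F a => StackProgram.conv (T x a) F) F).length ≤ F.length + k.length * N ∧
      ∀ b ∈ k.foldl (fun F a => StackProgram.conv (T x a) F) F, b.length ≤ w + k.length := by
    intro k
    induction k with
    | nil => intro F w _ _ hF; simpa using hF
    | cons a k ih =>
      intro F w hk hw hF
      have h3 := hk a List.mem_cons_self
      have h4 : size (T x a) = size (T x a).1 + size (T x a).2 + 1 := size_mk _ _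
      have h5 := length_lt_size (T x a).1
      have h6 := length_le_size (T x a).2
      have h7 := length_conv (T x a) F
      have h8 := width_conv (T x a) w (by omega) (fun b hb => by
        have := size_mem hb
        have := length_lt_size b
        omega) F hF
      obtain ⟨h9, h10⟩ := ih (StackProgram.conv (T x a) F) (w + 1)
        (fun a' ha' => hk a' (List.mem_cons_of_mem _ ha')) (by omega) h8
      refine ⟨?_, fun b hb => ?_⟩
      · simp only [List.foldl_cons, List.length_cons, add_mul]
        omega
      · have := h10 b hb
        simp only [List.length_cons]
        omega
  obtain ⟨h3, h4⟩ := h2 l' [[]] N h1 le_rfl (by simp)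
  have h5 : l'.length ≤ L.eval (size x) :=
    (length_le_size l').trans ((size_prefix hl').trans (hL x))
  refine (size_le_width _ _ h4).trans ?_
  simp only [Polynomial.eval_add, Polynomial.eval_mul, Polynomial.eval_comp, Polynomial.eval_X,
    Polynomial.eval_one, Polynomial.eval_ofNat, hN]
  simp only [List.length_singleton] at h3
  gcongr
  exact h3.trans (by gcongr)

/-! ### The decision procedure -/

/-- The profile of an order: which of its parties, from top to bottom, are in the coalition. -/
def profile (A : List Bool) (o : List (List Bool)) : List Bool := o.map (lookup A)

@[fun_prop]
theorem PT.profile {f : α → List Bool} {g : α → List (List Bool)} (hf : PT f) (hg : PT g) :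
    PT (fun a => profile (f a) (g a)) :=
  .map (f := fun a o => StackProgram.lookup (f a) o) hg (by fun_prop)

/-- Is there an entry `c` of the list such that the cost `c` is within the budget `B` and its
position `G` satisfies `a * K ≤ b * (G + S)`? -/
def search (F : List (List Bool)) (B a b : List Bool) (K S : List Unit) : Bool :=
  (F.foldl (fun s c => (() :: s.1, s.2 || (binLe c B && binLe (mulUnary a K) (mulUnary b s.1))))
    (S, false)).2

/-- The unary counter starts with `S` and grows by one per entry, so at position $G$ its length is
$G+|S|$. Therefore `S` varies in the induction. -/
theorem search_iff (F : List (List Bool)) (B a b : List Bool) (K S : List Unit) :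
    search F B a b K S = true ↔ ∃ G, Attains F G (val B) ∧
      val a * K.length ≤ val b * (G + S.length) := by
  suffices h : ∀ r, (F.foldl (fun s c => (() :: s.1, s.2 || (binLe c B &&
      binLe (mulUnary a K) (mulUnary b s.1)))) (S, r)).2 = true ↔
      r = true ∨ ∃ G, Attains F G (val B) ∧ val a * K.length ≤ val b * (G + S.length) by
    simpa [search] using h false
  induction F generalizing S with
  | nil => intro r; simp [attains_nil]
  | cons c F ih =>
    intro r
    rw [List.foldl_cons, ih]
    simp only [Bool.or_eq_true, Bool.and_eq_true, binLe_iff, val_mulUnary, List.length_cons,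
      or_assoc]
    refine or_congr_right ⟨?_, ?_⟩
    · rintro (⟨h1, h2⟩ | ⟨G, h1, h2⟩)
      · exact ⟨0, by simpa [attains_cons_zero] using h1, by simpa using h2⟩
      · exact ⟨G + 1, by simpa [attains_cons_succ] using h1, by
          convert h2 using 2; omega⟩
    · rintro ⟨G, h1, h2⟩
      cases G with
      | zero => exact Or.inl ⟨by simpa [attains_cons_zero] using h1, by simpa using h2⟩
      | succ G =>
        exact Or.inr ⟨G, by simpa [attains_cons_succ] using h1, by convert h2 using 2; omega⟩

theorem PT.search {F : α → List (List Bool)} {B a b : α → List Bool} {K S : α → List Unit}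
    (hF : PT F) (hB : PT B) (ha : PT a) (hb : PT b) (hK : PT K) (hS : PT S) :
    PT (fun x => search (F x) (B x) (a x) (b x) (K x) (S x)) := by
  refine .snd (.foldl_add (step := fun x s c => (() :: s.1, s.2 || (StackProgram.binLe c (B x) &&
    StackProgram.binLe (StackProgram.mulUnary (a x) (K x)) (StackProgram.mulUnary (b x) s.1))))
    hF (by fun_prop) (by fun_prop) ⟨4, fun x s c => ?_⟩)
  have h1 := size_bool_le (s.2 || (StackProgram.binLe c (B x) &&
    StackProgram.binLe (StackProgram.mulUnary (a x) (K x)) (StackProgram.mulUnary (b x) s.1)))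
  have h2 : size s = size s.1 + size s.2 + 1 := size_mk _ _
  have h3 : 1 ≤ size s.2 := by cases s.2 <;> simp
  simp only [size_mk, size_cons, size_unit, Polynomial.eval_ofNat]
  omega

/-- The input of the dynamic program: the coalition, the voters' orders and price data, numerator and
denominator of the target support and the budget. -/
abbrev Input (τ : Type) : Type :=
  List Bool × (List (List (List Bool) × τ) × (List Bool × (List Bool × List Bool)))

/-- The decision procedure; `T` computes the table of the costs of a voter for the gains
`0, …, G` from the price data of the voter and from `G` in unary. -/
def solve {τ : Type} (T : τ × List Unit → List Bool × List (List Bool)) (x : Input τ) : Bool :=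
  search (costTable (fun v => T (v.2, pairCount (fun b => !b) (profile x.1 v.1))) x.2.1)
    x.2.2.2.2 x.2.2.1 x.2.2.2.1
    (x.2.1.flatMap fun v => pairCount (fun _ => true) ((profile x.1 v.1).map fun _ => true))
    (x.2.1.flatMap fun v => pairCount (fun _ => true) (profile x.1 v.1).reverse)

theorem solve_iff {τ : Type} (T : τ × List Unit → List Bool × List (List Bool)) (A : List Bool)
    {n : ℕ} (w : Fin n → List (List Bool) × τ) (a b B : List Bool) :
    solve T (A, (List.ofFn w, (a, (b, B)))) = true ↔ ∃ g k : Fin n → ℕ, ∑ i, k i ≤ val B ∧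
      (∀ i, Attains ((T ((w i).2, pairCount (fun b => !b) (profile A (w i).1))).1 ::
        (T ((w i).2, pairCount (fun b => !b) (profile A (w i).1))).2) (g i) (k i)) ∧
      val a * ∑ i, (pairCount (fun _ => true) ((profile A (w i).1).map fun _ => true)).length ≤
        val b * (∑ i, g i +
          ∑ i, (pairCount (fun _ => true) (profile A (w i).1).reverse).length) := by
  have hsum : ∀ f : List (List Bool) × τ → List Unit,
      ((List.ofFn w).flatMap f).length = ∑ i, (f (w i)).length := fun f => by
    rw [List.length_flatMap, List.map_ofFn, List.sum_ofFn]
    rfl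
  rw [solve, search_iff]
  simp only [attains_costTable, hsum]
  constructor
  · rintro ⟨G, ⟨g, k, rfl, hk, h⟩, h'⟩
    exact ⟨g, k, hk, h, h'⟩
  · rintro ⟨g, k, hk, h, h'⟩
    exact ⟨_, ⟨g, k, rfl, hk, h⟩, h'⟩

theorem PT.solve {τ : Type} [Enc τ] {T : τ × List Unit → List Bool × List (List Bool)}
    (hT : PT T) : PT (solve T) := by
  have h1 : PT (fun x : Input τ => StackProgram.costTable (fun v => T (v.2, StackProgram.pairCount (fun b => !b)
      (StackProgram.profile x.1 v.1))) x.2.1) :=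
    .costTable (T := fun (x : Input τ) (v : List (List Bool) × τ) => T (v.2,
      StackProgram.pairCount (fun b => !b) (StackProgram.profile x.1 v.1))) (by fun_prop)
      (by fun_prop)
  have h2 : PT (fun z : Input τ × (List (List Bool) × τ) =>
      (StackProgram.profile z.1.1 z.2.1).map fun _ => true) :=
    .map (f := fun _ _ => true) (by fun_prop) (by fun_prop)
  have h3 : PT (fun x : Input τ => x.2.1.flatMap fun v =>
      StackProgram.pairCount (fun _ => true) ((StackProgram.profile x.1 v.1).map fun _ => true)) :=
    .flatMap (f := fun (x : Input τ) (v : List (List Bool) × τ) =>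
      StackProgram.pairCount (fun _ => true) ((StackProgram.profile x.1 v.1).map fun _ => true))
      (by fun_prop) (by fun_prop)
  have h4 : PT (fun x : Input τ => x.2.1.flatMap fun v =>
      StackProgram.pairCount (fun _ => true) (StackProgram.profile x.1 v.1).reverse) :=
    .flatMap (f := fun (x : Input τ) (v : List (List Bool) × τ) =>
      StackProgram.pairCount (fun _ => true) (StackProgram.profile x.1 v.1).reverse)
      (by fun_prop) (by fun_prop)
  exact .search h1 (by fun_prop) (by fun_prop) (by fun_prop) h3 h4

end

end StackProgram

namespace StackProgram

open Computability (Γ')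
open Enc

/-! ### Parsing the input -/

theorem val_encodeNat (k : ℕ) : val (Computability.encodeNat k) = k := by
  have h : ∀ p : PosNum, val (Computability.encodePosNum p) = (p : ℕ) := by
    intro p
    induction p with
    | one => simp [Computability.encodePosNum, val]
    | bit0 p ih => simp [Computability.encodePosNum, val, ih]; omega
    | bit1 p ih => simp [Computability.encodePosNum, val, ih]; omega
  have h' : ∀ n : Num, val (Computability.encodeNum n) = (n : ℕ) := by
    intro n
    cases n with
    | zero => simp [Computability.encodeNum, val]
    | pos p => simpa [Computability.encodeNum] using h p
  rw [Computability.encodeNat, h', Num.to_of_nat]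

/-- Move the input to the stack of the reversed input. -/
def reverseInput : Prog Alph :=
  .loop .inp Option.isSome
    (.ite .inp (· = some .comma) (.seq (.pop .inp) (.push .rev .comma))
    (.ite .inp (· = some .bra) (.seq (.pop .inp) (.push .rev .bra))
    (.ite .inp (· = some .ket) (.seq (.pop .inp) (.push .rev .ket))
    (.ite .inp (· = some .blank) (.seq (.pop .inp) (.push .rev .blank))
    (.ite .inp (· = some (.bit true)) (.seq (.pop .inp) (.push .rev (.bit true)))
    (.seq (.pop .inp) (.push .rev (.bit false))))))))

theorem reverseInput_runs (l : List Γ') : ∀ r m x, Runs reverseInput (st m x [] l r [])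
    (st m x [] [] (l.reverse ++ r) []) (8 * l.length + 1) := by
  induction l with
  | nil => exact fun r m x => .loop_done rfl
  | cons a l ih =>
    intro r m x
    have h : ∀ a : Γ', Runs (.seq (.pop .inp) (.push .rev a)) (st m x [] (a :: l) r [])
        (st m x [] l (a :: r) []) 2 := fun a =>
      .seq (n := 1) (n' := 1) (.pop_eq rfl) (.push_eq (by simp))
    have := ih (a :: r) m x
    refine Runs.conv (.loop_step (n := 7) (by simp) ?_ this) (by simp) (by simp; omega)
    cases a with
    | comma => exact (Runs.ite_true (by simp) (h _)).mono (by omega)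
    | bra => exact (Runs.ite_false (by simp) (.ite_true (by simp) (h _))).mono (by omega)
    | ket =>
      exact (Runs.ite_false (by simp) (.ite_false (by simp) (.ite_true (by simp) (h _)))).mono
        (by omega)
    | blank =>
      exact (Runs.ite_false (by simp) (.ite_false (by simp) (.ite_false (by simp)
        (.ite_true (by simp) (h _))))).mono (by omega)
    | bit b =>
      cases b with
      | true =>
        exact (Runs.ite_false (by simp) (.ite_false (by simp) (.ite_false (by simp)
          (.ite_false (by simp) (.ite_true (by simp) (h _)))))).mono (by omega)
      | false =>
        exact (Runs.ite_false (by simp) (.ite_false (by simp) (.ite_false (by simp)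
          (.ite_false (by simp) (.ite_false (by simp) (h _)))))).mono (by omega)

/-- Add the bit on top of the reversed input to the list on top of the main stack. -/
def consBit : Prog Alph :=
  .ite .rev (· = some (.bit true))
    (.seq (.pop .rev) (.seq (.push .main false) (.seq (.push .main false)
      (.seq (.push .main true) (.push .main true)))))
    (.seq (.pop .rev) (.seq (.push .main false) (.push .main true)))

/-- Is this symbol a bit? -/
def isBit : Option Γ' → Bool
  | some (.bit _) => true
  | _ => false

/-- Read the input from right to left. A closing bracket and a comma start a new list on top of the
main stack, and bits are added to this list. An opening bracket, or the end of a sequence of bits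
before a comma, adds the list on top to the list beneath it. -/
def parse : Prog Alph :=
  .loop .rev Option.isSome
    (.ite .rev (· = some .ket) (.seq (.pop .rev) (.push .main false))
    (.ite .rev (· = some .bra) (.seq (.pop .rev) (.push .main true))
    (.ite .rev (· = some .comma) (.seq (.pop .rev) (.seq (.push .main false)
      (.seq (.loop .rev isBit consBit) (.push .main true))))
    consBit)))

/-- The stacks during the parsing. -/
abbrev pst (m : List Bool) (r : List Γ') : ∀ k, List (Alph k) := st m (fun _ => []) [] [] r []

theorem consBit_runs (b : Bool) (r : List Γ') (m : List Bool) :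
    Runs consBit (pst m (.bit b :: r)) (pst (true :: ((enc b).ser ++ m)) r) 6 := by
  cases b with
  | true =>
    exact .ite_true (n := 5) (by simp) (.seq (n := 1) (n' := 4) (.pop_eq rfl)
      (.seq (n := 1) (n' := 3) (.push_eq rfl) (.seq (n := 1) (n' := 2) (.push_eq rfl)
      (.seq (n := 1) (n' := 1) (.push_eq rfl) (.push_eq (by simp [enc_true, D.ser]))))))
  | false =>
    exact (Runs.ite_false (n := 3) (by simp) (.seq (n := 1) (n' := 2) (.pop_eq rfl)
      (.seq (n := 1) (n' := 1) (.push_eq rfl)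
        (.push_eq (by simp [enc_false, D.ser]))))).mono (by omega)

/-- Add trees to the list on top of the main stack. -/
def pushAll (ds : List D) (m : List Bool) : List Bool :=
  ds.foldr (fun d m => true :: (d.ser ++ m)) m

theorem pushAll_append (ds ds' : List D) (m : List Bool) :
    pushAll (ds ++ ds') m = pushAll ds (pushAll ds' m) := by simp [pushAll]

theorem pushAll_enc {α : Type} [Enc α] (l : List α) (m : List Bool) :
    pushAll (l.map enc) (false :: m) = (enc l).ser ++ m := by
  induction l with
  | nil => rfl
  | cons a l ih => rw [enc_cons, List.map_cons]; simpa [D.ser, pushAll] using ih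

theorem bitLoop_runs (l : List Bool) : ∀ (r : List Γ') (m : List Bool), isBit r.head? = false →
    Runs (.loop .rev isBit consBit) (pst m (l.map .bit ++ r))
      (pst (pushAll (l.reverse.map enc) m) r) (7 * l.length + 1) := by
  induction l with
  | nil => exact fun r m h => .loop_done h
  | cons b l ih =>
    intro r m h
    refine Runs.conv (.loop_step rfl (consBit_runs b _ m) (ih r _ h)) ?_ (by simp; omega)
    simp [pushAll_append]
    rfl

/-- Parsing the string `u` adds the trees `ds` to the list on top of the main stack. -/
def Parses (u : List Γ') (ds : List D) : Prop :=
  ∀ r m S n, isBit r.head? = false → Runs parse (pst (pushAll ds m) r) S n →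
    Runs parse (pst m (u.reverse ++ r)) S (n + 12 * u.length)

/-- The string is nonempty and does not end with a bit. -/
def Terminated (u : List Γ') : Prop := ∀ r, isBit (u.reverse ++ r).head? = false

/-- Reading from right to left meets `u'` first. If `u` ended with a bit, the loop collecting the
digits of a number at the start of `u'` would run on into `u`. -/
theorem Parses.append {u u' : List Γ'} {ds ds' : List D} (h : Parses u ds) (ht : Terminated u)
    (h' : Parses u' ds') : Parses (u ++ u') (ds ++ ds') := by
  intro r m S n hr hS
  rw [List.reverse_append, List.append_assoc]
  rw [pushAll_append] at hS
  have := h' (u.reverse ++ r) m S _ (ht r) (h r _ S n hr hS)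
  exact this.mono (by simp; omega)

theorem parses_nil : Parses [] [] := fun _ _ _ _ _ h => h

theorem terminated_concat (u : List Γ') (a : Γ') (h : isBit (some a) = false) :
    Terminated (u ++ [a]) := by intro r; simpa using h

theorem parses_bits (l : List Bool) : Parses (l.map .bit) (l.map enc) := by
  induction l with
  | nil => exact parses_nil
  | cons b l ih =>
    intro r m S n hr hS
    rw [List.map_cons, List.reverse_cons, List.append_assoc]
    have h1 : Runs parse (pst (pushAll (l.map enc) m) (.bit b :: r)) S (n + 10) := by
      refine Runs.mono (.loop_step rfl (.ite_false (by simp) (.ite_false (by simp)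
        (.ite_false (by simp) (consBit_runs b r _)))) hS) (by omega)
    clear hS
    -- Nothing is assumed about the preceding symbol here, since inside the string it is again a
    -- bit.
    have key : ∀ (l : List Bool) (r' : List Γ') (m : List Bool) S n,
        Runs parse (pst (pushAll (l.map enc) m) r') S n →
        Runs parse (pst m ((l.map Γ'.bit).reverse ++ r')) S (n + 12 * l.length) := by
      intro l
      induction l with
      | nil => exact fun r' m S n h => h
      | cons b l ih =>
        intro r' m S n h
        rw [List.map_cons, List.reverse_cons, List.append_assoc]
        refine Runs.mono (ih (.bit b :: r') m S (n + 10) ?_) (by simp; omega)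
        exact Runs.mono (.loop_step rfl (.ite_false (by simp) (.ite_false (by simp)
          (.ite_false (by simp) (consBit_runs b r' _)))) h) (by omega)
    exact (key l _ m S _ h1).mono (by simp; omega)

theorem parses_block {u : List Γ'} {α : Type} [Enc α] {l : List α} (h : Parses u (l.map enc)) :
    Parses (CoalitionBribery.block u) [enc l] := by
  intro r m S n hr hS
  have e : (CoalitionBribery.block u).reverse ++ r = .ket :: (u.reverse ++ (.bra :: r)) := by
    simp [CoalitionBribery.block]
  rw [e]
  have h1 : Runs parse (pst (pushAll (l.map enc) (false :: m)) (.bra :: r)) S (n + 6) := by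
    rw [pushAll_enc]
    exact Runs.mono (.loop_step (S' := pst (pushAll [enc l] m) r) rfl (.ite_false (by simp)
      (.ite_true (by simp) (.seq (n := 1) (n' := 1) (.pop_eq rfl)
        (.push_eq (by simp [pushAll]))))) hS) (by omega)
  refine Runs.mono (.loop_step (n := 3) (S' := pst (false :: m) (u.reverse ++ (.bra :: r))) rfl
    (.ite_true (by simp) (.seq (n := 1) (n' := 1) (.pop_eq rfl) (.push_eq (by simp)))) (h (.bra :: r) (false :: m) S _ rfl h1)) ?_
  simp [CoalitionBribery.block]
  omega

theorem terminated_block (u : List Γ') : Terminated (CoalitionBribery.block u) :=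
  terminated_concat (.bra :: u) .ket rfl

theorem parses_encNat (k : ℕ) :
    Parses (CoalitionBribery.encNat k) [enc (Computability.encodeNat k)] := by
  intro r m S n hr hS
  have e : (CoalitionBribery.encNat k).reverse ++ r =
      .comma :: ((Computability.encodeNat k).reverse.map .bit ++ r) := by
    simp [CoalitionBribery.encNat, Computability.encodingNatΓ', Computability.inclusionBoolΓ']
  have e' : (CoalitionBribery.encNat k).length = (Computability.encodeNat k).length + 1 := by
    simp [CoalitionBribery.encNat, Computability.encodingNatΓ']
  have h1 := bitLoop_runs (Computability.encodeNat k).reverse r (false :: m) hr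
  rw [List.reverse_reverse, pushAll_enc] at h1
  rw [e, e']
  refine Runs.mono (.loop_step (S' := pst (pushAll [enc (Computability.encodeNat k)] m) r) rfl
    (.ite_false (by simp) (.ite_false (by simp) (.ite_true (by simp)
    (.seq (n := 1) (.pop_eq rfl) (.seq (n := 1) (S' := pst (false :: m)
      ((Computability.encodeNat k).reverse.map .bit ++ r)) (.push_eq (by simp))
      (.seq (n' := 1) h1 (.push_eq (by simp [pushAll])))))))) hS) ?_
  simp
  omega

theorem terminated_encNat (k : ℕ) : Terminated (CoalitionBribery.encNat k) :=
  terminated_concat _ .comma rfl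

theorem parses_flatten {α β : Type} [Enc α] (f : β → List Γ') (e : β → α)
    (h : ∀ b, Parses (f b) [enc (e b)]) (ht : ∀ b, Terminated (f b)) (l : List β) :
    Parses (l.map f).flatten ((l.map e).map enc) := by
  induction l with
  | nil => exact parses_nil
  | cons b l ih => simpa using (h b).append (ht b) ih

theorem parses_blockOf {α : Type} [Enc α] {k : ℕ} (f : Fin k → List Γ') (e : Fin k → α)
    (h : ∀ b, Parses (f b) [enc (e b)]) (ht : ∀ b, Terminated (f b)) :
    Parses (CoalitionBribery.blockOf f) [enc (List.ofFn e)] := by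
  refine parses_block ?_
  have := parses_flatten f e h ht (List.finRange k)
  rwa [← List.ofFn_eq_map, ← List.ofFn_eq_map] at this

theorem terminated_blockOf {k : ℕ} (f : Fin k → List Γ') :
    Terminated (CoalitionBribery.blockOf f) := terminated_block _

theorem parses_bitBlock {k : ℕ} (f : Fin k → Bool) :
    Parses (CoalitionBribery.blockOf fun c => [Γ'.bit (f c)]) [enc (List.ofFn f)] := by
  refine parses_block ?_
  have := parses_bits (List.ofFn f)
  convert this using 1
  rw [List.ofFn_eq_map, List.ofFn_eq_map, List.map_map]
  induction List.finRange k with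
  | nil => rfl
  | cons c l ih => simpa using ih

/-! ### From programs to Turing machines -/

/-- Move the answer from the main stack to the output. -/
def output : Prog Alph :=
  .ite .main (· = some true)
    (.seq (.pop .main) (.seq (.pop .main) (.seq (.pop .main) (.push .out true))))
    (.seq (.pop .main) (.push .out false))

theorem output_runs (b : Bool) :
    Runs output (mst (enc b).ser) (st [] (fun _ => []) [] [] [] [b]) 5 := by
  cases b with
  | true =>
    exact .ite_true (n := 4) rfl (.seq (n := 1) (n' := 3) (.pop_eq rfl) (.seq (n := 1) (n' := 2)
      (.pop_eq rfl) (.seq (n := 1) (n' := 1) (.pop_eq rfl)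
      (.push_eq (by simp [enc_true, D.ser])))))
  | false =>
    exact (Runs.ite_false (n := 2) rfl (.seq (n := 1) (n' := 1) (.pop_eq rfl)
      (.push_eq (by simp [enc_false, D.ser])))).mono (by omega)

/-- The machine reverses the input, parses it onto the main stack, computes `f`, and moves the
answer to the output. The initial `false` is the `nil` that ends the top-level list of parsed trees.
-/
theorem solvableInPolyTime {α β : Type} [Enc β] {e : α → List Γ'} {P : α → Prop} (g : α → β)
    {f : β → Bool} (hf : PT f) (hfP : ∀ a, f (g a) = true ↔ P a)
    (hg : ∀ a, ∃ ds, Parses (e a) ds ∧ pushAll ds [false] = (enc (g a)).ser) :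
    CoalitionBribery.SolvableInPolyTime e P := by
  obtain ⟨p, T, hp⟩ := hf
  refine ⟨fun a => f (g a), hfP, ⟨?_⟩⟩
  let q : Prog Alph :=
    .seq reverseInput (.seq (.push .main false) (.seq parse (.seq p output)))
  -- Reversing takes 8 and parsing 12 steps per symbol. The size bound $12\ell+2$ for the parsed
  -- tree is read off from the parsing time, and `9` includes the halting step.
  let time : Polynomial ℕ := 20 * Polynomial.X + 9 + T.comp (12 * Polynomial.X + 2)
  have hrun : ∀ a, Runs q (st [] (fun _ => []) [] (e a) [] [])
      (st [] (fun _ => []) [] [] [] [f (g a)])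
      (20 * (e a).length + 8 + T.eval (12 * (e a).length + 2)) := by
    intro a
    obtain ⟨ds, h1, h2⟩ := hg a
    have h3 := h1 [] [false] (pst (enc (g a)).ser []) 1 rfl (by
      rw [h2]; exact .loop_done rfl)
    have h4 : size (g a) ≤ 12 * (e a).length + 2 := by
      have := h3.length_le .main
      simp only [st_main, List.length_singleton] at this
      simp only [size]
      omega
    have h5 := hp (g a) []
    rw [List.append_nil, List.append_nil] at h5
    have h6 := eval_mono T h4
    rw [List.append_nil] at h3
    refine Runs.mono (.seq (reverseInput_runs (e a) [] [] _) (.seq (S' := pst [false]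
      (e a).reverse) (n := 1) (.push_eq (by simp)) (.seq h3 (.seq h5 (output_runs _))))) ?_
    omega
  have e1 : ∀ l, st [] (fun _ => []) [] l [] [] =
      Function.update (fun k => ([] : List (Alph k))) .inp l := by
    intro l
    funext k
    cases k <;> rfl
  have e2 : ∀ l, st [] (fun _ => []) [] [] [] l =
      Function.update (fun k => ([] : List (Alph k))) .out l := by
    intro l
    funext k
    cases k <;> rfl
  refine
    { tm := machine (Γ := Alph) .inp .out q
      inputAlphabet := Equiv.refl Γ'
      outputAlphabet := Equiv.refl Bool
      time := time
      outputsFun := fun a => Classical.choice ?_ }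
  have h := machine_outputs Stk.inp Stk.out q ((e a).map (Equiv.refl Γ').invFun) [f (g a)] _ (by
    have := hrun a
    rw [show List.map (Equiv.refl Γ').invFun (e a) = e a from List.map_id _]
    rwa [e1, e2] at this)
  have ht : time.eval (e a).length =
      20 * (e a).length + 8 + T.eval (12 * (e a).length + 2) + 1 := by
    simp [time]
    omega
  rw [ht]
  exact h

end StackProgram

namespace CoalitionBribery

/-! ### Points and gains -/

/-- The Borda points of a set of parties, as a natural number. -/
def bordaPoints {m : ℕ} (O : PrefOrder m) (A : Finset (Fin m)) : ℕ :=
  ∑ c ∈ A, ∑ y, if O c < O y then 1 else 0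

/-- The pairs of a party of the coalition and a party outside of it which is above the first one. -/
def gainPairs {m : ℕ} (O : PrefOrder m) (A : Finset (Fin m)) : Finset (Fin m × Fin m) :=
  Finset.univ.filter fun q => q.1 ∈ A ∧ q.2 ∉ A ∧ O q.2 < O q.1

theorem mem_gainPairs {m : ℕ} {O : PrefOrder m} {A : Finset (Fin m)} {x y : Fin m} :
    (x, y) ∈ gainPairs O A ↔ x ∈ A ∧ y ∉ A ∧ O y < O x := by simp [gainPairs]

theorem above_iff {m : ℕ} {O : PrefOrder m} {x y : Fin m} : Above O x y ↔ O x < O y := by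
  simp [Above, pos]

theorem mem_swappedPairs {m : ℕ} {O O' : PrefOrder m} {x y : Fin m} :
    (x, y) ∈ swappedPairs O O' ↔ O x < O y ∧ O' y < O' x := by
  simp [swappedPairs, above_iff]

theorem card_gainPairs {m : ℕ} (O : PrefOrder m) (A : Finset (Fin m)) :
    (gainPairs O A).card = ∑ c ∈ A, ∑ y ∈ Aᶜ, if O y < O c then 1 else 0 := by
  rw [← Finset.sum_product', ← Finset.card_filter]
  congr 1
  ext ⟨x, y⟩
  simp [mem_gainPairs, and_assoc]

/-- A pair of members yields exactly one point, and a member with an outsider yields either one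
point or one gain pair. So points and gain pairs add up to $\binom{|A|}2+|A||A^c|$; the doubled form
avoids division and subtraction. -/
theorem bordaPoints_add_gain {m : ℕ} (O : PrefOrder m) (A : Finset (Fin m)) :
    2 * (bordaPoints O A + (gainPairs O A).card) + A.card =
      A.card * A.card + 2 * (A.card * Aᶜ.card) := by
  have h1 : bordaPoints O A = (∑ c ∈ A, ∑ y ∈ A, if O c < O y then 1 else 0) +
      ∑ c ∈ A, ∑ y ∈ Aᶜ, if O c < O y then 1 else 0 := by
    rw [bordaPoints, ← Finset.sum_add_distrib]
    exact Finset.sum_congr rfl fun c _ => (Finset.sum_add_sum_compl A _).symm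
  have h2 : (∑ c ∈ A, ∑ y ∈ Aᶜ, if O c < O y then 1 else 0) + (gainPairs O A).card =
      A.card * Aᶜ.card := by
    rw [card_gainPairs, ← Finset.sum_add_distrib, Finset.card_eq_sum_ones, Finset.sum_mul]
    refine Finset.sum_congr rfl fun c hc => ?_
    rw [← Finset.sum_add_distrib, one_mul, Finset.card_eq_sum_ones]
    refine Finset.sum_congr rfl fun y hy => ?_
    have hne : O c ≠ O y := fun h => by
      rw [O.injective h] at hc
      exact (Finset.mem_compl.1 hy) hc
    rcases lt_or_gt_of_ne hne with h | h <;> simp [h, h.le, not_lt.2]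
  have h3 : 2 * (∑ c ∈ A, ∑ y ∈ A, if O c < O y then 1 else 0) + A.card =
      A.card * A.card := by
    have h4 : (∑ c ∈ A, ∑ y ∈ A, if O c < O y then 1 else 0) =
        ∑ c ∈ A, ∑ y ∈ A, if O y < O c then 1 else 0 := Finset.sum_comm
    rw [two_mul]
    nth_rw 2 [h4]
    rw [← Finset.sum_add_distrib, Finset.card_eq_sum_ones, Finset.sum_mul,
      ← Finset.sum_add_distrib]
    refine Finset.sum_congr rfl fun c hc => ?_
    -- The diagonal accounts for the summand $|A|$: for each $y$, exactly one of above, below and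
    -- equal holds.
    have h5 : (∑ y ∈ A, if y = c then 1 else 0) = 1 := by simp [hc]
    rw [one_mul, ← Finset.sum_add_distrib]
    refine (congrArg (_ + ·) h5.symm).trans ?_
    rw [← Finset.sum_add_distrib]
    refine Finset.sum_congr rfl fun y _ => ?_
    rcases lt_trichotomy (O c) (O y) with h | h | h
    · have : y ≠ c := by rintro rfl; exact lt_irrefl _ h
      simp [h, h.le, not_lt.2, this]
    · simp [O.injective h]
    · have : y ≠ c := by rintro rfl; exact lt_irrefl _ h
      simp [h, h.le, not_lt.2, this]
  omega

theorem bordaPoints_gain {m : ℕ} (O O' : PrefOrder m) (A : Finset (Fin m)) :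
    bordaPoints O' A + (gainPairs O' A).card = bordaPoints O A + (gainPairs O A).card := by
  have h1 := bordaPoints_add_gain O A
  have h2 := bordaPoints_add_gain O' A
  omega

/-! ### Shifting the coalition -/

/-- A gain pair that disappears has been swapped, so the gain is at most the number of swapped
pairs. -/
theorem card_gainPairs_le {m : ℕ} (O O' : PrefOrder m) (A : Finset (Fin m)) :
    (gainPairs O A).card ≤ (gainPairs O' A).card + (swappedPairs O O').card := by
  have h : gainPairs O A ⊆ gainPairs O' A ∪ (swappedPairs O O').image Prod.swap := by
    rintro ⟨x, y⟩ h
    obtain ⟨hx, hy, h⟩ := mem_gainPairs.1 h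
    by_cases h' : O' y < O' x
    · exact Finset.mem_union_left _ (mem_gainPairs.2 ⟨hx, hy, h'⟩)
    · refine Finset.mem_union_right _ (Finset.mem_image.2 ⟨(y, x), mem_swappedPairs.2 ⟨h, ?_⟩, rfl⟩)
      refine lt_of_le_of_ne (not_lt.1 h') fun e => ?_
      exact hy (O'.injective e ▸ hx)
  exact (Finset.card_le_card h).trans ((Finset.card_union_le _ _).trans
    (Nat.add_le_add_left Finset.card_image_le _))

/-- If some party outside of the coalition is above a party of the coalition, then there are two
such parties at adjacent positions. -/
theorem exists_adjacent {m : ℕ} (O : PrefOrder m) (A : Finset (Fin m)) (h : (gainPairs O A).Nonempty) :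
    ∃ x ∈ A, ∃ y ∉ A, (O x : ℕ) = O y + 1 := by
  obtain ⟨⟨x, y⟩, hxy⟩ := h
  obtain ⟨hx, hy, hlt⟩ := mem_gainPairs.1 hxy
  -- Take the highest member below `y`. The party directly above it is either `y` or, by minimality,
  -- another outsider.
  obtain ⟨c, hc, hmin⟩ := Finset.exists_min_image (A.filter fun c => O y < O c) O
    ⟨x, Finset.mem_filter.2 ⟨hx, hlt⟩⟩
  obtain ⟨hcA, hyc⟩ := Finset.mem_filter.1 hc
  rw [Fin.lt_def] at hyc
  refine ⟨c, hcA, O.symm ⟨O c - 1, by omega⟩, fun hz => ?_, by simp; omega⟩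
  have hne : (O y : ℕ) ≠ O c - 1 := fun e => hy (by
    have : O.symm ⟨O c - 1, by omega⟩ = y := by
      rw [Equiv.symm_apply_eq]; exact Fin.ext e.symm
    rwa [this] at hz)
  have := hmin _ (Finset.mem_filter.2 ⟨hz, by rw [Fin.lt_def]; simp; omega⟩)
  rw [Fin.le_def] at this
  simp at this
  omega

/-- Moving the coalition upwards by exactly `g` swaps. -/
theorem exists_shift {m : ℕ} (O : PrefOrder m) (A : Finset (Fin m)) (g : ℕ) :
    g ≤ (gainPairs O A).card → ∃ O' : PrefOrder m,
      (∀ x ∈ A, ∀ y ∉ A, ¬ (O x < O y ∧ O' y < O' x)) ∧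
      (gainPairs O' A).card + g = (gainPairs O A).card ∧ (swappedPairs O O').card ≤ g := by
  induction g with
  | zero =>
    intro _
    refine ⟨O, fun x _ y _ h => lt_asymm h.1 h.2, rfl, ?_⟩
    rw [Nat.le_zero, Finset.card_eq_zero, Finset.eq_empty_iff_forall_notMem]
    rintro ⟨x, y⟩ h
    have := mem_swappedPairs.1 h
    exact lt_asymm this.1 this.2
  | succ g ih =>
    intro hg
    obtain ⟨O', hperm, hgain, hswap⟩ := ih (by omega)
    obtain ⟨x, hx, y, hy, hxy⟩ := exists_adjacent O' A (Finset.card_pos.1 (by omega))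
    have hne : x ≠ y := fun e => hy (e ▸ hx)
    let O'' : PrefOrder m := (Equiv.swap x y).trans O'
    have ex : O'' x = O' y := by simp [O'']
    have ey : O'' y = O' x := by simp [O'']
    have inj : ∀ z w, z = w ↔ (O' z : ℕ) = O' w := fun z w =>
      ⟨fun h => by rw [h], fun h => O'.injective (Fin.ext h)⟩
    have ev : ∀ z, (O'' z : ℕ) = if (O' z : ℕ) = O' x then (O' y : ℕ) else
        if (O' z : ℕ) = O' y then (O' x : ℕ) else O' z := fun z => by
      simp only [← inj]
      split_ifs with h1 h2
      · rw [h1, ex]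
      · rw [h2, ey]
      · simp [O'', Equiv.swap_apply_of_ne_of_ne h1 h2]
    -- Exchanging neighbours changes the relative order of these two parties only; consequently
    -- exactly one gain pair is lost and at most one swapped pair is new.
    have key : ∀ z w, ¬ (z = y ∧ w = x) → ¬ (z = x ∧ w = y) → (O'' z < O'' w ↔ O' z < O' w) := by
      intro z w h1 h2
      rw [inj, inj] at h1 h2
      rw [Fin.lt_def, Fin.lt_def, ev z, ev w]
      split_ifs <;> omega
    have hlt : O'' x < O'' y := by rw [ex, ey, Fin.lt_def]; omega
    refine ⟨O'', ?_, ?_, ?_⟩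
    · rintro a ha b hb ⟨h1, h2⟩
      by_cases h3 : b = y ∧ a = x
      · rw [h3.1, h3.2] at h2
        exact lt_asymm h2 hlt
      · refine hperm a ha b hb ⟨h1, (key b a h3 ?_).1 h2⟩
        rintro ⟨rfl, rfl⟩
        exact hb hx
    · have e : gainPairs O'' A = (gainPairs O' A).erase (x, y) := by
        ext ⟨a, b⟩
        rw [Finset.mem_erase, mem_gainPairs, mem_gainPairs, Ne, Prod.mk.injEq]
        constructor
        · rintro ⟨ha, hb, h⟩
          have h3 : ¬ (a = x ∧ b = y) := by
            rintro ⟨rfl, rfl⟩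
            exact lt_asymm h hlt
          refine ⟨h3, ha, hb, (key b a (fun h => h3 h.symm) ?_).1 h⟩
          rintro ⟨rfl, rfl⟩
          exact hb hx
        · rintro ⟨h3, ha, hb, h⟩
          refine ⟨ha, hb, (key b a (fun h => h3 h.symm) ?_).2 h⟩
          rintro ⟨rfl, rfl⟩
          exact hb hx
      have hmem : (x, y) ∈ gainPairs O' A :=
        mem_gainPairs.2 ⟨hx, hy, by rw [Fin.lt_def]; omega⟩
      have := Finset.card_erase_add_one hmem
      rw [e]
      omega
    · have hsub : swappedPairs O O'' ⊆ insert (y, x) (swappedPairs O O') := by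
        rintro ⟨a, b⟩ h
        obtain ⟨h1, h2⟩ := mem_swappedPairs.1 h
        by_cases h3 : a = y ∧ b = x
        · rw [h3.1, h3.2]
          exact Finset.mem_insert_self _ _
        · refine Finset.mem_insert_of_mem (mem_swappedPairs.2 ⟨h1, (key b a ?_ ?_).1 h2⟩)
          · rintro ⟨rfl, rfl⟩
            exact lt_asymm h2 hlt
          · exact fun h => h3 h.symm
      exact (Finset.card_le_card hsub).trans ((Finset.card_insert_le _ _).trans (by omega))

/-! ### The reformulation of the problem -/

theorem borda_eq {m : ℕ} (O : PrefOrder m) (c : Fin m) :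
    borda m O c = ((∑ y, if O c < O y then 1 else 0 : ℕ) : ℚ) := by
  have h : (∑ y, if O c < O y then 1 else 0 : ℕ) = ∑ r, if O c < r then 1 else 0 :=
    Equiv.sum_comp O fun r => if O c < r then 1 else 0
  rw [h, ← Finset.card_filter, Finset.filter_lt_eq_Ioi, Fin.card_Ioi, borda, pos]
  have := (O c).isLt
  rw [Nat.sub_sub, Nat.cast_sub (by omega)]
  push_cast
  ring

theorem points_borda {m n : ℕ} (O : Fin n → PrefOrder m) (S : Finset (Fin m)) :
    points (borda m) O S = ((∑ i, bordaPoints (O i) S : ℕ) : ℚ) := by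
  simp only [points, borda_eq, bordaPoints]
  push_cast
  rfl

/-- Points are nonnegative, so with threshold $0$ every party is active. -/
theorem seatsOf_borda {m n : ℕ} (O : Fin n → PrefOrder m) (S : Finset (Fin m)) :
    seatsOf (borda m) 0 O S = points (borda m) O S / points (borda m) O Finset.univ := by
  have h1 : activeParties (borda m) 0 O = Finset.univ := by
    refine Finset.filter_true_of_mem fun c _ => ?_
    rw [zero_mul, not_lt, points_borda]
    exact Nat.cast_nonneg _
  have h2 : ∀ S : Finset (Fin m), ∑ c ∈ S, points (borda m) O {c} = points (borda m) O S := by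
    intro S
    simp only [points, Finset.sum_singleton]
    exact Finset.sum_comm
  simp only [seatsOf, seats, h1, Finset.mem_univ, if_true, h2]
  rw [← Finset.sum_div, h2]

theorem bordaPoints_univ_pos {m : ℕ} (hm : 2 ≤ m) (O : PrefOrder m) :
    0 < bordaPoints O Finset.univ := by
  refine Finset.sum_pos' (fun _ _ => Nat.zero_le _) ⟨O.symm ⟨0, by omega⟩, Finset.mem_univ _, ?_⟩
  refine Finset.sum_pos' (fun _ _ => Nat.zero_le _) ⟨O.symm ⟨1, by omega⟩, Finset.mem_univ _, ?_⟩
  simp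

/-- With the whole set as coalition there are no outsiders, hence no gain pairs. -/
theorem bordaPoints_univ {m : ℕ} (O O' : PrefOrder m) :
    bordaPoints O Finset.univ = bordaPoints O' Finset.univ := by
  have h1 := bordaPoints_add_gain O Finset.univ
  have h2 := bordaPoints_add_gain O' Finset.univ
  have h3 : ∀ O : PrefOrder m, (gainPairs O Finset.univ).card = 0 := fun O => by
    simp [gainPairs]
  rw [h3] at h1 h2
  omega

/-- The total is positive and unaffected by the bribe, so it can be taken from the original orders
and cleared together with the denominator of $\varphi$. -/
theorem seats_condition {m n : ℕ} (hm : 2 ≤ m) (hn : 1 ≤ n) (O O' : Fin n → PrefOrder m)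
    (A : Finset (Fin m)) (φ : ℚ) (hφ : 0 ≤ φ) :
    seatsOf (borda m) 0 O' A ≥ φ * seatsOf (borda m) 0 O' Finset.univ ↔
      φ.num.natAbs * ∑ i, bordaPoints (O i) Finset.univ ≤ φ.den * ∑ i, bordaPoints (O' i) A := by
  have e : ∑ i, bordaPoints (O i) Finset.univ = ∑ i, bordaPoints (O' i) Finset.univ :=
    Finset.sum_congr rfl fun i _ => bordaPoints_univ _ _
  have hpos : 0 < ∑ i, bordaPoints (O' i) Finset.univ :=
    Finset.sum_pos (fun i _ => bordaPoints_univ_pos hm _) ⟨⟨0, by omega⟩, Finset.mem_univ _⟩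
  rw [e]
  simp only [seatsOf_borda, points_borda]
  generalize ∑ i, bordaPoints (O' i) Finset.univ = T at hpos
  generalize ∑ i, bordaPoints (O' i) A = p
  have hT : (0 : ℚ) < T := Nat.cast_pos.2 hpos
  have hd : (0 : ℚ) < φ.den := Nat.cast_pos.2 φ.den_pos
  have hnum : ((φ.num.natAbs : ℕ) : ℚ) = φ * φ.den := by
    rw [Rat.mul_den_eq_num]
    have := Int.natAbs_of_nonneg (Rat.num_nonneg.2 hφ)
    rw [← Int.cast_natCast, this]
  rw [div_self hT.ne', mul_one, ge_iff_le, le_div_iff₀ hT, ← Nat.cast_le (α := ℚ)]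
  push_cast
  rw [hnum, mul_assoc, mul_left_comm, mul_le_mul_iff_right₀ hd]

/-- If `R i g k` describes that the coalition can gain `g` points from the voter `i` at the cost `k`,
then the problem is a multiple-choice knapsack problem. -/
theorem cb_iff {Price : ℕ → ℕ → Type} (rules : {m n : ℕ} → Finset (Fin m) → Price m n →
    BriberyRules m n) (I : Instance Price) (R : Fin I.n → ℕ → ℕ → Prop)
    (h1 : ∀ i O', (rules I.A I.price).permissible i (I.order i) O' → ∃ g,
      bordaPoints O' I.A ≤ bordaPoints (I.order i) I.A + g ∧
      R i g ((rules I.A I.price).cost i (I.order i) O'))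
    (h2 : ∀ i g k, R i g k → ∃ O', (rules I.A I.price).permissible i (I.order i) O' ∧
      (rules I.A I.price).cost i (I.order i) O' ≤ k ∧
      bordaPoints (I.order i) I.A + g ≤ bordaPoints O' I.A) :
    CB borda 0 rules I ↔ ∃ g k : Fin I.n → ℕ, ∑ i, k i ≤ I.B ∧ (∀ i, R i (g i) (k i)) ∧
      I.φ.num.natAbs * ∑ i, bordaPoints (I.order i) Finset.univ ≤
        I.φ.den * (∑ i, g i + ∑ i, bordaPoints (I.order i) I.A) := by
  constructor
  · rintro ⟨O', hperm, hcost, hseats⟩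
    choose g hg hR using fun i => h1 i (O' i) (hperm i)
    refine ⟨g, _, hcost, hR, ?_⟩
    rw [seats_condition I.two_le_m I.one_le_n I.order O' I.A I.φ I.φ_nonneg] at hseats
    refine hseats.trans (Nat.mul_le_mul_left _ ?_)
    rw [add_comm, ← Finset.sum_add_distrib]
    exact Finset.sum_le_sum fun i _ => hg i
  · rintro ⟨g, k, hk, hR, h⟩
    choose O' hperm hcost hpts using fun i => h2 i (g i) (k i) (hR i)
    refine ⟨O', hperm, (Finset.sum_le_sum fun i _ => hcost i).trans hk, ?_⟩
    rw [seats_condition I.two_le_m I.one_le_n I.order O' I.A I.φ I.φ_nonneg]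
    refine h.trans (Nat.mul_le_mul_left _ ?_)
    rw [add_comm, ← Finset.sum_add_distrib]
    exact Finset.sum_le_sum fun i _ => hpts i

end CoalitionBribery

namespace CoalitionBribery

open StackProgram
open Computability (Γ' encodeNat)

/-! ### The algorithms for the three bribery types -/

theorem profile_ofFn {m : ℕ} (O : PrefOrder m) (A : Finset (Fin m)) :
    profile (List.ofFn fun c => decide (c ∈ A)) (List.ofFn fun r => encodeNat (O.symm r)) =
      List.ofFn fun r => decide (O.symm r ∈ A) := by
  rw [profile, List.map_ofFn]
  congr 1
  funext r
  simp [lookup_eq, val_encodeNat]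

/-- In the profile, a gain pair is a `false` followed later by a `true`. -/
theorem length_pairCount_gain {m : ℕ} (O : PrefOrder m) (A : Finset (Fin m)) :
    (pairCount (fun b => !b) (List.ofFn fun r => decide (O.symm r ∈ A))).length =
      (gainPairs O A).card := by
  rw [pairCount_length, ← Equiv.sum_comp O, card_gainPairs, ← Finset.sum_filter_add_sum_filter_not
    Finset.univ (· ∈ A), Finset.filter_mem_eq_inter, Finset.univ_inter]
  rw [Finset.sum_eq_zero (s := Finset.univ.filter (· ∉ A)), add_zero]
  · refine Finset.sum_congr rfl fun c hc => ?_
    rw [← Equiv.sum_comp O, ← Finset.sum_filter_add_sum_filter_not Finset.univ (· ∈ A),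
      Finset.sum_eq_zero, zero_add]
    · refine Finset.sum_congr (by ext; simp) fun y hy => ?_
      have : y ∉ A := by simpa using hy
      simp [hc, this]
    · intro y hy
      have : y ∈ A := by simpa using hy
      simp [this]
  · intro c hc
    have : c ∉ A := by simpa using hc
    simp [this]

/-- In the reversed profile, the entries before a member belong to the parties ranked below it, one
point each. -/
theorem length_pairCount_points {m : ℕ} (O : PrefOrder m) (A : Finset (Fin m)) :
    (pairCount (fun _ => true) (List.ofFn fun r => decide (O.symm r ∈ A)).reverse).length =
      bordaPoints O A := by
  have e : (List.ofFn fun r => decide (O.symm r ∈ A)).reverse =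
      List.ofFn fun r : Fin m => decide (O.symm r.rev ∈ A) := by
    refine List.ext_getElem (by simp) fun i h1 h2 => ?_
    simp only [List.getElem_reverse, List.getElem_ofFn, List.length_ofFn]
    congr 3
    ext
    simp [Fin.val_rev]
    omega
  rw [e, pairCount_length, ← Equiv.sum_comp (O.trans Fin.revPerm),
    ← Finset.sum_filter_add_sum_filter_not Finset.univ (· ∈ A), Finset.filter_mem_eq_inter,
    Finset.univ_inter, bordaPoints, Finset.sum_eq_zero (s := Finset.univ.filter (· ∉ A)), add_zero]
  · refine Finset.sum_congr rfl fun c hc => ?_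
    rw [← Equiv.sum_comp (O.trans Fin.revPerm)]
    refine Finset.sum_congr rfl fun y _ => ?_
    simp [hc]
  · intro c hc
    have : c ∉ A := by simpa using hc
    simp [this]

theorem length_pairCount_total {m : ℕ} (O : PrefOrder m) (u : Fin m → Bool) :
    (pairCount (fun _ => true) ((List.ofFn u).map fun _ => true)).length =
      bordaPoints O Finset.univ := by
  rw [List.map_ofFn, pairCount_length, Finset.sum_comm, ← Equiv.sum_comp O, bordaPoints]
  refine Finset.sum_congr rfl fun c _ => ?_
  rw [← Equiv.sum_comp O]
  simp

section
variable {Price : ℕ → ℕ → Type}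

/-- The characteristic vector of the coalition. -/
def coalitionBits (I : Instance Price) : List Bool := List.ofFn fun c => decide (c ∈ I.A)

/-- The parties, in binary, from top to bottom. -/
def orderBits {m : ℕ} (O : PrefOrder m) : List (List Bool) :=
  List.ofFn fun r => encodeNat (O.symm r)

/-- The maximal gain of the coalition from a voter, in unary. -/
def gainList (I : Instance Price) (i : Fin I.n) : List Unit :=
  pairCount (fun b => !b) (profile (coalitionBits I) (orderBits (I.order i)))

theorem length_gainList (I : Instance Price) (i : Fin I.n) :
    (gainList I i).length = (gainPairs (I.order i) I.A).card := by
  rw [gainList, coalitionBits, orderBits, profile_ofFn, length_pairCount_gain]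

theorem solve_iff_cb {τ : Type} (rules : {m n : ℕ} → Finset (Fin m) → Price m n →
    BriberyRules m n) (I : Instance Price) (T : τ × List Unit → List Bool × List (List Bool))
    (price : Fin I.n → τ)
    (h1 : ∀ i O', (rules I.A I.price).permissible i (I.order i) O' → ∃ g,
      bordaPoints O' I.A ≤ bordaPoints (I.order i) I.A + g ∧
      Attains ((T (price i, gainList I i)).1 :: (T (price i, gainList I i)).2) g
        ((rules I.A I.price).cost i (I.order i) O'))
    (h2 : ∀ i g k, Attains ((T (price i, gainList I i)).1 :: (T (price i, gainList I i)).2) g k →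
      ∃ O', (rules I.A I.price).permissible i (I.order i) O' ∧
      (rules I.A I.price).cost i (I.order i) O' ≤ k ∧
      bordaPoints (I.order i) I.A + g ≤ bordaPoints O' I.A) :
    solve T (coalitionBits I, (List.ofFn fun i => (orderBits (I.order i), price i),
      (encodeNat I.φ.num.natAbs, (encodeNat I.φ.den, encodeNat I.B)))) = true ↔
      CB borda 0 rules I := by
  rw [cb_iff rules I _ h1 h2, solve_iff]
  simp only [val_encodeNat]
  have e1 : ∀ i, (pairCount (fun _ => true) ((profile (coalitionBits I)
      (orderBits (I.order i))).map fun _ => true)).length =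
      bordaPoints (I.order i) Finset.univ := fun i => by
    rw [coalitionBits, orderBits, profile_ofFn, length_pairCount_total]
  have e2 : ∀ i, (pairCount (fun _ => true) (profile (coalitionBits I)
      (orderBits (I.order i))).reverse).length = bordaPoints (I.order i) I.A := fun i => by
    rw [coalitionBits, orderBits, profile_ofFn, length_pairCount_points]
  simp only [e1, e2]
  rfl

/-- The first elements of a list, as many as the length of another list says. -/
def takeUnary (u : List Unit) (s : List (List Bool)) : List (List Bool) :=
  (u.foldl (fun r _ => (r.1.tail, r.1.head?.getD [] :: r.2)) (s, ([] : List (List Bool)))).2.reverse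

theorem takeUnary_eq (u : List Unit) (s : List (List Bool)) (h : u.length ≤ s.length) :
    takeUnary u s = s.take u.length := by
  suffices key : ∀ (u : List Unit) (s r : List (List Bool)), u.length ≤ s.length →
      (u.foldl (fun r _ => (r.1.tail, r.1.head?.getD [] :: r.2)) (s, r)).2.reverse =
        r.reverse ++ s.take u.length by
    simpa [takeUnary] using key u s [] h
  intro u
  induction u with
  | nil => intro s r _; simp
  | cons _ u ih =>
    intro s r h
    cases s with
    | nil => simp at h
    | cons a s =>
      rw [List.foldl_cons, ih _ _ (by simpa using h)]
      simp

theorem PT.takeUnary {α : Type} [Enc α] {f : α → List Unit} {g : α → List (List Bool)}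
    (hf : PT f) (hg : PT g) : PT (fun a => takeUnary (f a) (g a)) := by
  refine .reverse (.snd (.foldl_add (step := fun _ (r : List (List Bool) × List (List Bool)) _ =>
      (r.1.tail, r.1.head?.getD [] :: r.2)) hf (by fun_prop) (by fun_prop) ⟨4, fun x r u => ?_⟩))
  obtain ⟨s, r⟩ := r
  cases s <;> simp <;> omega

/-- The table of the costs for `$`-bribery. -/
def dollarTable (x : List Bool × List Unit) : List Bool × List (List Bool) :=
  ([], x.2.map fun _ => x.1)

/-- The table of the costs for `1`-bribery. -/
def oneTable (x : Unit × List Unit) : List Bool × List (List Bool) := dollarTable ([true], x.2)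

/-- The table of the costs for coalition-shift-bribery. -/
def shiftTable (x : List (List Bool) × List Unit) : List Bool × List (List Bool) :=
  (x.1.head?.getD [], takeUnary x.2 x.1.tail)

theorem pt_dollarTable : PT dollarTable := by
  have : PT (fun x : List Bool × List Unit => x.2.map fun _ => x.1) :=
    .map (f := fun (x : List Bool × List Unit) _ => x.1) (by fun_prop) (by fun_prop)
  unfold dollarTable
  fun_prop

theorem pt_oneTable : PT oneTable :=
  pt_dollarTable.comp (f := fun x : Unit × List Unit => ([true], x.2)) (by fun_prop)

theorem pt_shiftTable : PT shiftTable := by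
  have : PT (fun x : List (List Bool) × List Unit => takeUnary x.2 x.1.tail) :=
    PT.takeUnary (by fun_prop) (by fun_prop)
  unfold shiftTable
  fun_prop

theorem attains_dollarTable (p : List Bool) (u : List Unit) (g k : ℕ) :
    Attains ((dollarTable (p, u)).1 :: (dollarTable (p, u)).2) g k ↔
      g ≤ u.length ∧ (g = 0 ∨ val p ≤ k) := by
  cases g with
  | zero => simp [dollarTable, attains_cons_zero, val]
  | succ g =>
    rw [attains_cons_succ]
    simp only [dollarTable, Attains, List.getElem?_map, Option.map_eq_some_iff]
    constructor
    · rintro ⟨_, ⟨_, h1, rfl⟩, h2⟩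
      obtain ⟨h, -⟩ := List.getElem?_eq_some_iff.1 h1
      exact ⟨h, Or.inr h2⟩
    · rintro ⟨h1, h2⟩
      exact ⟨p, ⟨(), by rw [List.getElem?_eq_getElem h1], rfl⟩, by simpa using h2⟩

/-- The table consists of the first $|u|+1$ values, for the gains $0,\dots,|u|$. The value at $0$ is
kept since it may be positive. -/
theorem attains_shiftTable {N : ℕ} (s : Fin (N + 1) → ℕ) (u : List Unit) (hu : u.length ≤ N)
    (g k : ℕ) :
    Attains ((shiftTable (List.ofFn fun d => encodeNat (s d), u)).1 ::
      (shiftTable (List.ofFn fun d => encodeNat (s d), u)).2) g k ↔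
      g ≤ u.length ∧ ∃ h : g < N + 1, s ⟨g, h⟩ ≤ k := by
  have e : (shiftTable (List.ofFn fun d => encodeNat (s d), u)).1 ::
      (shiftTable (List.ofFn fun d => encodeNat (s d), u)).2 =
      (List.ofFn fun d => encodeNat (s d)).take (u.length + 1) := by
    rw [shiftTable, takeUnary_eq _ _ (by simpa using hu), List.ofFn_succ]
    simp
  rw [e]
  constructor
  · rintro ⟨b, h1, h2⟩
    obtain ⟨h3, rfl⟩ := List.getElem?_eq_some_iff.1 h1
    simp only [List.length_take, List.length_ofFn] at h3
    refine ⟨by omega, by omega, ?_⟩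
    simpa only [List.getElem_take, List.getElem_ofFn, val_encodeNat] using h2
  · rintro ⟨h1, h2, h3⟩
    refine ⟨encodeNat (s ⟨g, h2⟩), ?_, by rwa [val_encodeNat]⟩
    rw [List.getElem?_take_of_lt (by omega), List.getElem?_eq_getElem (by simpa using h2)]
    simp only [List.getElem_ofFn]

/-- A changed order costs the same whatever the gain, so only the reachable gains matter. Rules and
table are kept general so that 1-bribery is covered too. -/
theorem dollar_solve (I : Instance Price) (rules : {m n : ℕ} → Finset (Fin m) → Price m n →
    BriberyRules m n) (p : Fin I.n → ℕ) (hr : rules I.A I.price = dollarBribery I.m p)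
    {τ : Type} (T : τ × List Unit → List Bool × List (List Bool)) (price : Fin I.n → τ)
    (hT : ∀ i u, ∃ b, T (price i, u) = dollarTable (b, u) ∧ val b = p i) :
    solve T (coalitionBits I, (List.ofFn fun i => (orderBits (I.order i), price i),
      (encodeNat I.φ.num.natAbs, (encodeNat I.φ.den, encodeNat I.B)))) = true ↔
      CB borda 0 rules I := by
  have h : ∀ i g k, Attains ((T (price i, gainList I i)).1 :: (T (price i, gainList I i)).2) g k ↔
      g ≤ (gainPairs (I.order i) I.A).card ∧ (g = 0 ∨ p i ≤ k) := fun i g k => by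
    obtain ⟨b, hb, hp⟩ := hT i (gainList I i)
    rw [hb, attains_dollarTable, length_gainList, hp]
  refine solve_iff_cb rules I T price ?_ ?_
  · intro i O' _
    have hgain := bordaPoints_gain (I.order i) O' I.A
    -- Truncated subtraction: a change that loses points counts as gain $0$.
    refine ⟨bordaPoints O' I.A - bordaPoints (I.order i) I.A, by omega, (h _ _ _).2 ⟨by omega, ?_⟩⟩
    rw [hr]
    by_cases e : O' = I.order i
    · left; rw [e]; exact Nat.sub_self _
    · right; simp [dollarBribery, e]
  · intro i g k hk
    obtain ⟨hg, hk⟩ := (h _ _ _).1 hk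
    rw [hr]
    rcases hk with rfl | hk
    · exact ⟨I.order i, trivial, by simp [dollarBribery], le_rfl⟩
    · obtain ⟨O', -, hO', -⟩ := exists_shift (I.order i) I.A g hg
      have hgain := bordaPoints_gain (I.order i) O' I.A
      refine ⟨O', trivial, ?_, by omega⟩
      simp only [dollarBribery]
      split_ifs <;> omega

/-- By monotonicity of the price functions, a gain of $g$ costs at least $s_i(g)$, as it needs $g$
swapped pairs, and `exists_shift` achieves it at this cost. -/
theorem shift_solve (I : Instance ShiftPrice) :
    solve shiftTable (coalitionBits I, (List.ofFn fun i => (orderBits (I.order i),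
      List.ofFn fun d => encodeNat (I.price i d)),
      (encodeNat I.φ.num.natAbs, (encodeNat I.φ.den, encodeNat I.B)))) = true ↔
      BordaCBShift I := by
  -- Lifting the coalition to the top swaps at least as many pairs as there are gain pairs, so the
  -- price table is long enough.
  have hle : ∀ i, (gainPairs (I.order i) I.A).card ≤ I.m.choose 2 := fun i => by
    obtain ⟨O', -, h1, -⟩ := exists_shift (I.order i) I.A _ le_rfl
    have h2 := card_gainPairs_le (I.order i) O' I.A
    have h3 := card_swappedPairs_lt (I.order i) O'
    omega
  have h : ∀ i g k, _ ↔ _ := fun i g k =>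
    attains_shiftTable (I.price i) (gainList I i) (by rw [length_gainList]; exact hle i) g k
  refine solve_iff_cb (fun A s => coalitionShiftBribery A s) I shiftTable
    (fun i => List.ofFn fun d => encodeNat (I.price i d)) ?_ ?_
  · intro i O' hO'
    have hgain := bordaPoints_gain (I.order i) O' I.A
    have h1 := card_gainPairs_le (I.order i) O' I.A
    have h2 : (gainPairs O' I.A).card ≤ (gainPairs (I.order i) I.A).card := by
      refine Finset.card_le_card ?_
      rintro ⟨x, y⟩ hxy
      obtain ⟨hx, hy, hlt⟩ := mem_gainPairs.1 hxy
      refine mem_gainPairs.2 ⟨hx, hy, ?_⟩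
      by_contra hcon
      refine hO' x hx y hy ⟨above_iff.2 (lt_of_le_of_ne (not_lt.1 hcon) fun e => ?_),
        above_iff.2 hlt⟩
      exact hy ((I.order i).injective e ▸ hx)
    have h3 := card_swappedPairs_lt (I.order i) O'
    refine ⟨(gainPairs (I.order i) I.A).card - (gainPairs O' I.A).card, by omega,
      (h i _ _).2 ⟨by rw [length_gainList]; omega, by omega, ?_⟩⟩
    exact (I.price i).monotone (Fin.mk_le_mk.2 (by omega))
  · intro i g k hk
    obtain ⟨hg, hlt, hk⟩ := (h i g k).1 hk
    rw [length_gainList] at hg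
    obtain ⟨O', hperm, hO', hswap⟩ := exists_shift (I.order i) I.A g hg
    have hgain := bordaPoints_gain (I.order i) O' I.A
    refine ⟨O', fun x hx y hy hxy => hperm x hx y hy ⟨above_iff.1 hxy.1, above_iff.1 hxy.2⟩,
      le_trans ((I.price i).monotone (Fin.mk_le_mk.2 hswap)) hk, by omega⟩

/-! ### Reading the instances -/

theorem parses_encOrder {m : ℕ} (O : PrefOrder m) :
    Parses (encOrder O) [Enc.enc (orderBits O)] :=
  parses_blockOf _ _ (fun _ => parses_encNat _) fun _ => terminated_encNat _

theorem parses_encInstance (encPrice : {m n : ℕ} → Price m n → List Γ') (I : Instance Price)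
    (ds : List D) (h : Parses (encPrice I.price) ds) :
    Parses (encInstance encPrice I) ([Enc.enc (coalitionBits I)] ++
      [Enc.enc (List.ofFn fun i => orderBits (I.order i))] ++ [Enc.enc (encodeNat I.φ.num.natAbs)] ++
      [Enc.enc (encodeNat I.φ.den)] ++ [Enc.enc (encodeNat I.B)] ++ ds) := by
  have ht : ∀ {u v : List Γ'}, Terminated v → Terminated (u ++ v) := fun h _ => by
    rw [List.reverse_append, List.append_assoc]
    exact h _
  have h1 : Parses (blockOf fun c : Fin I.m => [Γ'.bit (decide (c ∈ I.A))])
    [Enc.enc (coalitionBits I)] := parses_bitBlock _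
  have h2 : Parses (blockOf fun i => encOrder (I.order i))
      [Enc.enc (List.ofFn fun i => orderBits (I.order i))] :=
    parses_blockOf _ _ (fun i => parses_encOrder _) fun _ => terminated_blockOf _
  exact ((((h1.append (terminated_blockOf _) h2).append (ht (terminated_blockOf _))
    (parses_encNat _)).append (ht (terminated_encNat _)) (parses_encNat _)).append
    (ht (terminated_encNat _)) (parses_encNat _)).append (ht (terminated_encNat _)) h

/-- Orders and prices form two separate lists in the encoding; this matches them voter by voter. -/
theorem zipLong_ofFn {α β : Type} {n : ℕ} (a : Fin n → α) (b : Fin n → β) :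
    zipLong (List.ofFn a) (List.ofFn b) = List.ofFn fun i => (some (a i), some (b i)) := by
  induction n with
  | zero => rfl
  | succ n ih => simp [List.ofFn_succ, zipLong, ih]

/-- The input of the dynamic program, from an instance without price data. -/
def inputOne (z : List Bool × (List (List (List Bool)) × (List Bool × (List Bool ×
    (List Bool × Unit))))) : Input Unit :=
  (z.1, (z.2.1.map fun o => (o, ()), (z.2.2.1, (z.2.2.2.1, z.2.2.2.2.1))))

/-- The input of the dynamic program, from an instance with a list of price data. -/
def inputPrices {σ : Type} (z : List Bool × (List (List (List Bool)) × (List Bool × (List Bool ×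
    (List Bool × (List (List σ) × Unit)))))) : Input (List σ) :=
  (z.1, ((zipLong z.2.1 z.2.2.2.2.2.1).map fun p => (p.1.getD [], p.2.getD []),
    (z.2.2.1, (z.2.2.2.1, z.2.2.2.2.1))))

theorem pt_inputOne : PT inputOne := by
  have : PT (fun z : List Bool × (List (List (List Bool)) × (List Bool × (List Bool ×
      (List Bool × Unit)))) => z.2.1.map fun o => (o, ())) :=
    .map (f := fun _ o => (o, ())) (by fun_prop) (by fun_prop)
  unfold inputOne
  fun_prop

theorem pt_inputPrices {σ : Type} [Enc σ] : PT (inputPrices (σ := σ)) := by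
  have : PT (fun z : List Bool × (List (List (List Bool)) × (List Bool × (List Bool ×
      (List Bool × (List (List σ) × Unit))))) =>
      (zipLong z.2.1 z.2.2.2.2.2.1).map fun p => (p.1.getD [], p.2.getD [])) :=
    .map (f := fun _ (p : Option (List (List Bool)) × Option (List σ)) =>
      (p.1.getD [], p.2.getD [])) (by fun_prop) (by fun_prop)
  unfold inputPrices
  fun_prop

end

/-! ### Polynomial-time solvability for the three bribery types -/

theorem solvable_one : SolvableInPolyTime (encInstance encOnePrice) BordaCBOne := by
  -- The final `()` is the `nil` ending the list of parsed trees.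
  refine solvableInPolyTime (fun I => (coalitionBits I, (List.ofFn fun i => orderBits (I.order i),
    (encodeNat I.φ.num.natAbs, (encodeNat I.φ.den, (encodeNat I.B, ()))))))
    ((PT.solve pt_oneTable).comp pt_inputOne) (fun I => ?_) fun I => ?_
  · have := dollar_solve I (fun {m n} _ _ => oneBribery m n) (fun _ => 1) rfl oneTable
      (fun _ => ()) fun _ u => ⟨[true], rfl, rfl⟩
    rw [BordaCBOne, ← this]
    simp [inputOne, List.map_ofFn, Function.comp_def]
  · refine ⟨_, parses_encInstance encOnePrice I [] parses_nil, ?_⟩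
    simp [pushAll, enc_mk, enc_unit, D.ser]

theorem solvable_dollar : SolvableInPolyTime (encInstance encDollarPrice) BordaCBDollar := by
  refine solvableInPolyTime (fun I => (coalitionBits I, (List.ofFn fun i => orderBits (I.order i),
    (encodeNat I.φ.num.natAbs, (encodeNat I.φ.den, (encodeNat I.B,
      (List.ofFn fun i => encodeNat (I.price i), ())))))))
    ((PT.solve pt_dollarTable).comp pt_inputPrices) (fun I => ?_) fun I => ?_
  · have := dollar_solve I (fun {m _} _ p => dollarBribery m p) I.price rfl dollarTable
      (fun i => encodeNat (I.price i)) fun i u => ⟨_, rfl, val_encodeNat _⟩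
    rw [BordaCBDollar, ← this]
    simp [inputPrices, zipLong_ofFn, List.map_ofFn, Function.comp_def]
  · refine ⟨_, parses_encInstance encDollarPrice I _ (parses_blockOf _ _
      (fun i => parses_encNat _) fun _ => terminated_encNat _), ?_⟩
    simp [pushAll, enc_mk, enc_unit, D.ser]

theorem solvable_shift : SolvableInPolyTime (encInstance encShiftPrice) BordaCBShift := by
  refine solvableInPolyTime (fun I => (coalitionBits I, (List.ofFn fun i => orderBits (I.order i),
    (encodeNat I.φ.num.natAbs, (encodeNat I.φ.den, (encodeNat I.B,
      (List.ofFn fun i => List.ofFn fun d => encodeNat (I.price i d), ())))))))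
    ((PT.solve pt_shiftTable).comp pt_inputPrices) (fun I => ?_) fun I => ?_
  · rw [← shift_solve]
    simp [inputPrices, zipLong_ofFn, List.map_ofFn, Function.comp_def]
  · refine ⟨_, parses_encInstance encShiftPrice I _ (parses_blockOf _ _
      (fun i => parses_blockOf _ _ (fun d => parses_encNat _) fun _ => terminated_encNat _)
      fun _ => terminated_blockOf _), ?_⟩
    simp [pushAll, enc_mk, enc_unit, D.ser]

end CoalitionBribery

/-- The coalition-bribery problem for Borda without threshold can be solved in polynomial time for
`1`-bribery, `$`-bribery and coalition-shift-bribery. -/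
theorem mainTheorem12 :
    CoalitionBribery.SolvableInPolyTime
      (CoalitionBribery.encInstance CoalitionBribery.encOnePrice)
      CoalitionBribery.BordaCBOne ∧
    CoalitionBribery.SolvableInPolyTime
      (CoalitionBribery.encInstance CoalitionBribery.encDollarPrice)
      CoalitionBribery.BordaCBDollar ∧
    CoalitionBribery.SolvableInPolyTime
      (CoalitionBribery.encInstance CoalitionBribery.encShiftPrice)
      CoalitionBribery.BordaCBShift :=
  ⟨CoalitionBribery.solvable_one, CoalitionBribery.solvable_dollar,
    CoalitionBribery.solvable_shift⟩
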